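/- **Setting.** Let $X^M$ be coordinates on the doubled space $\mathbb R^{2D}$; indices are raised and lowered with the constant $O(D,D)$ metric $\begin{pmatrix}0&1\\1&0\end{pmatrix}$. Let $\mathcal A$ be an algebra of smooth real functions on $\mathbb R^{2D}$, containing the constants and closed under the derivatives $\partial_M$, that satisfies the strong constraint: $\partial^P\partial_P f=0$ and $\partial^P f\,\partial_P g=0$ for all $f,g\in\mathcal A$. Let $\lambda$ be a formal expansion parameter. Scalars are elements of $\mathcal A[[\lambda]]$, vectors are $2D$-tuples of scalars, and a *parameter* $\xi^M$ is a vector without term of order $\lambda^0$, so that the exponentials and series below are well defined order by order in $\lambda$. A vector is *trivial* if it equals $\partial^M f$ for a scalar $f$; it is *quasi-trivial* if at each order in $\lambda$ it is a finite sum $\sum_i\rho_i\,\partial^M\eta_i$ with $\rho_i,\eta_i\in\mathcal A$. Put $$(\hat{\mathcal L}_\xi V)_M=\xi^K\partial_K V_M+(\partial_M\xi^K-\partial^K\xi_M)V_K,\qquad \mathcal G(\xi)=e^{-\xi^P\partial_P}\,e^{\hat{\mathcal L}_\xi}$$ (operators on vectors), and $$[\xi,\eta]_C^M=\xi^P\partial_P\eta^M-\eta^P\partial_P\xi^M-\tfrac12\left(\xi^P\partial^M\eta_P-\eta^P\partial^M\xi_P\right).$$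 For parameters $\xi,\chi$ put $$\delta_{\mathrm{BCH}}(\xi,\chi)=\chi+\tfrac12[\xi,\chi]_C+\tfrac1{12}\big([\xi,[\xi,\chi]_C]_C+[\chi,[\chi,\xi]_C]_C\big)+\cdots,$$ where $\cdots$ are the terms of degree at least four of the Baker–Campbell–Hausdorff series in Dynkin's form, with right-nested C-brackets. **Theorem.** 1. For every parameter $\xi$ and every quasi-trivial parameter $\delta$ there is a quasi-trivial parameter $\chi$ with $\mathcal G(\xi+\delta)=\mathcal G(\xi)\,\mathcal G(\chi)$ and with $\delta=\delta_{\mathrm{BCH}}(\xi,\chi)$ up to addition of a trivial vector. 2. Conversely, let $\xi$ be a parameter and $\chi$ a quasi-trivial parameter. Then $\delta_{\mathrm{BCH}}(\xi,\chi)$ is a parameter, and every parameter $\delta$ that equals $\delta_{\mathrm{BCH}}(\xi,\chi)$ up to addition of a trivial vector is quasi-trivial and satisfies $\mathcal G(\xi+\delta)=\mathcal G(\xi)\,\mathcal G(\chi)$. 3. Suppose moreover that $\mathcal A$ consists of all smooth functions that are constant along some fixed maximal isotropic ($D$-dimensional) subspace of $\mathbb R^{2D}$. Say that $\xi$ and $\xi'$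 *agree at* $X_0\in\mathbb R^{2D}$ if $(e^{-\xi^P\partial_P}f)(X_0)=(e^{-\xi'^P\partial_P}f)(X_0)$ for all $f\in\mathcal A$. Then, for all parameters $\xi,\xi'$: the difference $\xi'-\xi$ is quasi-trivial if and only if $\xi$ and $\xi'$ agree at some point and $\mathcal G(\xi')=\mathcal G(\xi)\,\mathcal G(\chi)$ for some quasi-trivial parameter $\chi$. In that case, for every such $\chi$, $\xi'-\xi=\delta_{\mathrm{BCH}}(\xi,\chi)$ up to addition of a trivial vector. -/

import Mathlib

open scoped ContDiff Nat

noncomputable section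

/-- `O(D,D)` indices `M`.  In the light-cone frame the `O(D,D)` metric is the off-diagonal block
matrix, so that raising or lowering an index `M` is the swap of the two blocks:
`∂^M = ∂_{swap M}` and `ξ_M = ξ^{swap M}`. -/
abbrev DIdx (D : ℕ) : Type := Fin D ⊕ Fin D

/-- The doubled space `ℝ^{2D}`, with coordinates `X^M`. -/
abbrev Doubled (D : ℕ) : Type := DIdx D → ℝ

/-- The partial derivative `∂_M f`. -/
def partialD {D : ℕ} (M : DIdx D) (f : Doubled D → ℝ) : Doubled D → ℝ :=
  fun X => fderiv ℝ f X (Pi.single M 1)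

/-- An algebra of smooth functions on the doubled space that is closed under partial derivatives
and satisfies the strong constraint: `∂^P ∂_P f = 0` and `∂^P f ∂_P g = 0` for all its elements.
Components of fields and parameters are taken from such an algebra. -/
structure FieldAlgebra (D : ℕ) extends Subalgebra ℝ (Doubled D → ℝ) where
  smooth : ∀ f ∈ carrier, ContDiff ℝ ∞ f
  partialD_mem : ∀ f ∈ carrier, ∀ M, partialD M f ∈ carrier
  box_eq_zero : ∀ f ∈ carrier, ∑ P : DIdx D, partialD P.swap (partialD P f) = 0
  grad_mul_grad : ∀ f ∈ carrier, ∀ g ∈ carrier,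
    ∑ P : DIdx D, partialD P.swap f * partialD P g = 0

namespace FieldAlgebra

variable {D : ℕ} (A : FieldAlgebra D)

/-- The algebra consists of all smooth functions that are constant along some maximal isotropic
subspace `N` of the doubled space (equivalently: of all smooth functions of half of the
coordinates, in a suitable `O(D,D)` frame). -/
def IsSection : Prop :=
  ∃ N : Submodule ℝ (Doubled D),
    Module.finrank ℝ N = D ∧
    (∀ v ∈ N, ∀ w ∈ N, ∑ P : DIdx D, v P.swap * w P = 0) ∧
    ∀ f : Doubled D → ℝ, f ∈ A.toSubalgebra ↔
      ContDiff ℝ ∞ f ∧ ∀ X : Doubled D, ∀ v ∈ N, f (X + v) = f X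

/-- Scalars: formal power series in an expansion parameter `lam` (counting orders), with coefficients in the
algebra. -/
abbrev Scalar : Type := PowerSeries A.toSubalgebra

/-- `2D`-tuples of scalars: generalized vectors `V_M` (index down) or `ξ^M` (index up). -/
abbrev Vec : Type := DIdx D → A.Scalar

variable {A}

/-- The partial derivative `∂_M`, acting coefficientwise. -/
def d (M : DIdx D) (f : A.Scalar) : A.Scalar :=
  PowerSeries.mk fun n =>
    ⟨partialD M (PowerSeries.coeff n f : A.toSubalgebra),
      A.partialD_mem _ (PowerSeries.coeff n f : A.toSubalgebra).2 M⟩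

/-- Gauge parameters: vectors `ξ^M` of order at least one in `lam`. -/
def IsParam (ξ : A.Vec) : Prop := ∀ M, PowerSeries.constantCoeff (ξ M) = 0

/-- Trivial vectors `∂^M f`. -/
def IsTrivial (ξ : A.Vec) : Prop := ∃ f : A.Scalar, ∀ M, ξ M = d M.swap f

/-- Quasi-trivial vectors: at each order in `lam` a finite sum `∑ i, ρ_i ∂^M η_i`. -/
def IsQuasiTrivial (ξ : A.Vec) : Prop :=
  ∀ n : ℕ, ∃ (k : ℕ) (ρ η : Fin k → A.toSubalgebra), ∀ M : DIdx D,
    ((PowerSeries.coeff n (ξ M) : A.toSubalgebra) : Doubled D → ℝ)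
      = ∑ i, (ρ i : Doubled D → ℝ) * partialD M.swap (η i : Doubled D → ℝ)

/-- The differential operator `ξ^P ∂_P` on scalars. -/
def transport (ξ : A.Vec) (f : A.Scalar) : A.Scalar := ∑ P, ξ P * d P f

/-- The generalized Lie derivative
`(L_ξ V)_M = ξ^K ∂_K V_M + (∂_M ξ^K - ∂^K ξ_M) V_K`. -/
def genLie (ξ V : A.Vec) : A.Vec := fun M =>
  transport ξ (V M) + ∑ K, (d M (ξ K) - d K.swap (ξ M.swap)) * V K

/-- The C-bracket
`[ξ, η]_C^M = ξ^P ∂_P η^M - η^P ∂_P ξ^M - 1/2 (ξ^P ∂^M η_P - η^P ∂^M ξ_P)`. -/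
def cBracket (ξ η : A.Vec) : A.Vec := fun M =>
  transport ξ (η M) - transport η (ξ M)
    - (1 / 2 : ℝ) • ∑ P, (ξ P * d M.swap (η P.swap) - η P * d M.swap (ξ P.swap))

/-- The exponential `∑ k, T^k / k!` of an operator on scalars that raises the order in `lam` by
at least one; only the terms with `k ≤ n` contribute at order `n`. -/
def expScalar (T : A.Scalar → A.Scalar) (f : A.Scalar) : A.Scalar :=
  PowerSeries.mk fun n =>
    ∑ k ∈ Finset.range (n + 1), ((k ! : ℝ)⁻¹) • PowerSeries.coeff n (T^[k] f)

/-- The exponential `∑ k, T^k / k!` of an operator on vectors that raises the order in `lam` by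
at least one; only the terms with `k ≤ n` contribute at order `n`. -/
def expVec (T : A.Vec → A.Vec) (V : A.Vec) : A.Vec := fun M =>
  PowerSeries.mk fun n =>
    ∑ k ∈ Finset.range (n + 1), ((k ! : ℝ)⁻¹) • PowerSeries.coeff n (T^[k] V M)

/-- The operator `G(ξ) = exp (- ξ^P ∂_P) exp (L_ξ)` on vectors `V_M`. -/
def largeG (ξ : A.Vec) (V : A.Vec) : A.Vec := fun M =>
  expScalar (transport (-ξ)) (expVec (genLie ξ) V M)

/-- The coordinate transformations `X' = exp (- ξ^P ∂_P) X` generated by `ξ` and by `ξ'` agree at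
the point `X₀`, as seen by all functions of the algebra. -/
def AgreeAt (ξ ξ' : A.Vec) (X₀ : Doubled D) : Prop :=
  ∀ (f : A.toSubalgebra) (n : ℕ),
    ((PowerSeries.coeff n (expScalar (transport (-ξ)) (PowerSeries.C f)) : A.toSubalgebra) :
        Doubled D → ℝ) X₀
      = ((PowerSeries.coeff n (expScalar (transport (-ξ')) (PowerSeries.C f)) : A.toSubalgebra) :
        Doubled D → ℝ) X₀

/-- Right-nested C-brackets `[w₁, [w₂, [..., [wₙ₋₁, wₙ]_C ...]_C]_C]_C` of a word. -/
def nested : List A.Vec → A.Vec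
  | [] => 0
  | [w] => w
  | w :: w' :: l => cBracket w (nested (w' :: l))

/-- The part of degree `N` of the Baker-Campbell-Hausdorff series of `ξ` and `χ`, in C-brackets
(Dynkin's formula): the sum, over `k` and over all `(r₁, s₁), ..., (r_k, s_k)` with `r_i + s_i > 0`
and `∑ (r_i + s_i) = N`, of
`(-1)^(k-1) / (k N ∏ r_i! s_i!) [ξ^{r₁} χ^{s₁} ... ξ^{r_k} χ^{s_k}]`. -/
def bchTerm (N : ℕ) (ξ χ : A.Vec) : A.Vec :=
  ∑ k ∈ Finset.Icc 1 N,
    ∑ p : Fin k → Fin (N + 1) × Fin (N + 1) with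
        (∀ i, 0 < ((p i).1 : ℕ) + (p i).2) ∧ ∑ i, (((p i).1 : ℕ) + (p i).2) = N,
      ((-1 : ℝ) ^ (k - 1) / (k * N * ∏ i, ((((p i).1 : ℕ) ! : ℝ) * (((p i).2 : ℕ) ! : ℝ)))) •
        nested (List.ofFn fun i =>
          List.replicate ((p i).1 : ℕ) ξ ++ List.replicate ((p i).2 : ℕ) χ).flatten

/-- The sum of the terms of degree at least four of the Baker-Campbell-Hausdorff series; the term
of degree `N` is of order at least `N` in `lam`. -/
def bchHigher (ξ χ : A.Vec) : A.Vec := fun M =>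
  PowerSeries.mk fun n => PowerSeries.coeff n (∑ N ∈ Finset.Icc 4 n, bchTerm N ξ χ M)

/-- The Baker-Campbell-Hausdorff series of `ξ` and `χ` in C-brackets, without its first term `ξ`:
`χ + 1/2 [ξ, χ] + 1/12 ([ξ, [ξ, χ]] + [χ, [χ, ξ]]) + ...`. -/
def bchDelta (ξ χ : A.Vec) : A.Vec :=
  χ + (1 / 2 : ℝ) • cBracket ξ χ
    + (1 / 12 : ℝ) • (cBracket ξ (cBracket ξ χ) + cBracket χ (cBracket χ ξ))
    + bchHigher ξ χ

end FieldAlgebra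

end

/-! The generalized Lie derivatives represent the C-bracket: by the strong constraint, the
commutator of `genLie ξ` and `genLie η` is `genLie (cBracket ξ η)` (`genLie_cBracket`). Hence every
identity between exponentials of operators that involves only commutators applies to them, in
particular the Baker-Campbell-Hausdorff formula in Dynkin's form: exp(L_ξ) exp(L_χ) = exp(L_ζ) with
ζ = ξ + `bchDelta ξ χ` (`expOp_genLieL_add_bchDelta`). No Jacobi identity for the C-bracket is
needed, because Dynkin's formula is natural under maps of bilinear brackets (`map_bchPart`) and is
proved for associative algebras (`expPS_bchPart`).

Quasi-trivial vectors form an ideal for the C-bracket (`cBracket_mem_quasiTrivial`) and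
differentiate every scalar to zero (`transport_quasiTrivial`). So for quasi-trivial χ the vector
`bchDelta ξ χ` is quasi-trivial, the factor exp(-ξ^P ∂_P) is not affected by adding it, and G(χ) =
exp(L_χ). This gives `largeG_add_bchDelta`. Trivial vectors have zero generalized Lie derivative,
which accounts for the ambiguity in part 2. For part 1, the equation `bchDelta ξ χ` = δ is solved
for χ by a contraction: `bchDelta ξ χ - χ` depends on χ only through brackets with further letters
of positive order (`exists_bchDelta_eq`).

Part 3 rests on a rigidity statement (`isTrivial_sub_of_largeG_eq`): if G(ξ) = G(η) and ξ, η agree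
at a point, then ξ - η is trivial. On gradients, G(ξ) is the conjugate of ∂_M by exp(ξ^P ∂_P)
(`largeG_grad`). Comparing leading orders, the first coefficient of (ξ - η)^P ∂_P f that could be
nonzero is constant for linear f, and agreement at one point makes it zero. By induction on the
order, ξ - η is tangent to the isotropic subspace N (`coeffAt_sub_mem`). The transport operators
then coincide, so the exponentials of the generalized Lie derivatives do, and these have unique
logarithms (`expOp_injective`). Thus ξ - η is a closed one-form after lowering its index, and the
Poincaré lemma gives a potential; isotropy of N makes the potential constant along N, so that it
lies in the algebra (`isTrivial_of_curl_eq_zero`). -/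

noncomputable section

/-! ### Complete filtered vector spaces and convergent series -/

/-- A real vector space with a complete, separated, decreasing filtration by subspaces. -/
class FilteredModule (M : Type*) [AddCommGroup M] [Module ℝ M] where
  fil : ℕ → Submodule ℝ M
  fil_succ_le : ∀ n, fil (n + 1) ≤ fil n
  fil_zero : fil 0 = ⊤
  eq_zero_of_mem : ∀ v, (∀ n, v ∈ fil n) → v = 0
  complete : ∀ u : ℕ → M, (∀ n, u (n + 1) - u n ∈ fil n) → ∃ v, ∀ n, v - u n ∈ fil n

open Finset.HasAntidiagonal (antidiagonal mem_antidiagonal)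

namespace FilteredModule

variable {M : Type*} [AddCommGroup M] [Module ℝ M] [FilteredModule M]
variable {M' : Type*} [AddCommGroup M'] [Module ℝ M'] [FilteredModule M']
variable {M'' : Type*} [AddCommGroup M''] [Module ℝ M''] [FilteredModule M'']

theorem fil_antitone : Antitone (fil (M := M)) := antitone_nat_of_succ_le fil_succ_le

theorem fil_mono {m n : ℕ} (h : m ≤ n) {v : M} (hv : v ∈ fil n) : v ∈ fil m := fil_antitone h hv

@[simp] theorem mem_fil_zero (v : M) : v ∈ fil 0 := by simp [fil_zero]

theorem eq_of_sub_mem {v w : M} (h : ∀ n, v - w ∈ fil n) : v = w :=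
  sub_eq_zero.1 (eq_zero_of_mem _ h)

/-- `v` is the sum of the series `u`, whose `k`-th term lies in the `k`-th step of the
filtration. -/
def SumsTo (u : ℕ → M) (v : M) : Prop := ∀ m, v - ∑ k ∈ Finset.range m, u k ∈ fil m

namespace SumsTo

variable {u u' : ℕ → M} {v v' : M}

theorem mem (h : SumsTo u v) (k : ℕ) : u k ∈ fil k := by
  have := (fil k).sub_mem (h k) (fil_succ_le _ (h (k + 1)))
  rw [Finset.sum_range_succ] at this
  convert this using 1
  abel

theorem unique (h : SumsTo u v) (h' : SumsTo u v') : v = v' :=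
  eq_of_sub_mem fun n => by
    have := (fil n).sub_mem (h n) (h' n)
    convert this using 1
    abel

theorem add (h : SumsTo u v) (h' : SumsTo u' v') : SumsTo (fun k => u k + u' k) (v + v') := by
  intro m
  convert (fil m).add_mem (h m) (h' m) using 1
  rw [Finset.sum_add_distrib]
  abel

theorem smul (c : ℝ) (h : SumsTo u v) : SumsTo (fun k => c • u k) (c • v) := by
  intro m
  convert (fil m).smul_mem c (h m) using 1
  rw [smul_sub, Finset.smul_sum]

theorem map (h : SumsTo u v) (T : M →ₗ[ℝ] M') (hT : ∀ n v, v ∈ fil n → T v ∈ fil n) :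
    SumsTo (fun k => T (u k)) (T v) := by
  intro m
  convert hT m _ (h m) using 1
  rw [map_sub, map_sum]

theorem mem_of_vanish (h : SumsTo u v) {n : ℕ} (hu : ∀ k < n, u k = 0) : v ∈ fil n := by
  have := h n
  rwa [Finset.sum_eq_zero fun k hk => hu k (Finset.mem_range.1 hk), sub_zero] at this

/-- Summation of a double series along its diagonals. -/
theorem diag {z : M} {w : ℕ → ℕ → M} {x : ℕ → M} (hz : SumsTo x z)
    (hw : ∀ i m, x i - ∑ j ∈ Finset.range m, w i j ∈ fil (i + m)) :
    SumsTo (fun n => ∑ p ∈ antidiagonal n, w p.1 p.2) z := by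
  intro m
  have e : ∑ n ∈ Finset.range m, ∑ p ∈ antidiagonal n, w p.1 p.2
      = ∑ i ∈ Finset.range m, ∑ j ∈ Finset.range (m - i), w i j := by
    rw [← Finset.sum_range_diag_flip]
    refine Finset.sum_congr rfl fun n _ => ?_
    rw [Finset.Nat.sum_antidiagonal_eq_sum_range_succ]
  have h2 : ∑ i ∈ Finset.range m, (x i - ∑ j ∈ Finset.range (m - i), w i j) ∈ fil m := by
    refine Submodule.sum_mem _ fun i hi => ?_
    have := hw i (m - i)
    rwa [Nat.add_sub_cancel' (Finset.mem_range.1 hi).le] at this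
  convert (fil m).add_mem (hz m) h2 using 1
  rw [e, Finset.sum_sub_distrib]
  abel

/-- The Cauchy product of two series. -/
theorem conv {x : ℕ → M} {a : M} {y : ℕ → M'} {b : M'} (hx : SumsTo x a) (hy : SumsTo y b)
    (B : M →ₗ[ℝ] M' →ₗ[ℝ] M'')
    (hB : ∀ i j v w, v ∈ fil i → w ∈ fil j → B v w ∈ fil (i + j)) :
    SumsTo (fun n => ∑ p ∈ antidiagonal n, B (x p.1) (y p.2)) (B a b) := by
  refine diag (x := fun i => B (x i) b) (w := fun i j => B (x i) (y j)) ?_ ?_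
  · exact hx.map (B.flip b) fun n v hv => hB n 0 v b hv (mem_fil_zero b)
  · intro i m
    convert hB i m _ _ (hx.mem i) (hy m) using 1
    rw [map_sub, map_sum]

/-- Interchange of the summations in a double series that vanishes below the diagonal. -/
theorem swap {z : M} {w : ℕ → ℕ → M} {x : ℕ → M} (hz : SumsTo x z)
    (hw : ∀ k, SumsTo (w k) (x k)) (h0 : ∀ k m, m < k → w k m = 0) :
    SumsTo (fun m => ∑ k ∈ Finset.range (m + 1), w k m) z := by
  intro n
  have h2 : ∑ k ∈ Finset.range n, (x k - ∑ m ∈ Finset.range n, w k m) ∈ fil n :=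
    Submodule.sum_mem _ fun k _ => hw k n
  have e : ∑ m ∈ Finset.range n, ∑ k ∈ Finset.range (m + 1), w k m
      = ∑ k ∈ Finset.range n, ∑ m ∈ Finset.range n, w k m := by
    rw [Finset.sum_comm]
    refine Finset.sum_congr rfl fun m hm => ?_
    refine Finset.sum_subset ?_ fun k _ hk => h0 _ _ ?_
    · intro k hk
      simp only [Finset.mem_range] at *
      omega
    · simp only [Finset.mem_range] at *
      omega
  convert (fil n).add_mem (hz n) h2 using 1
  rw [e, Finset.sum_sub_distrib]
  abel

end SumsTo

theorem exists_sumsTo {u : ℕ → M} (hu : ∀ k, u k ∈ fil k) : ∃ v, SumsTo u v :=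
  complete (fun m => ∑ k ∈ Finset.range m, u k) fun n => by
    simpa [Finset.sum_range_succ] using hu n

/-- A map that is contracting for the filtration on a closed set has a fixed point there. -/
theorem exists_fixedPoint (P : Set M) {v₀ : M} (h0 : v₀ ∈ P)
    (hP : ∀ v, (∀ n, ∃ u ∈ P, v - u ∈ fil n) → v ∈ P) (Φ : M → M) (hΦ : ∀ v ∈ P, Φ v ∈ P)
    (hc : ∀ n, ∀ v ∈ P, ∀ w ∈ P, v - w ∈ fil n → Φ v - Φ w ∈ fil (n + 1)) :
    ∃ v ∈ P, Φ v = v := by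
  have hmem : ∀ n, Φ^[n] v₀ ∈ P := fun n => by
    induction n with
    | zero => exact h0
    | succ n ih => rw [Function.iterate_succ_apply']; exact hΦ _ ih
  have hstep : ∀ n, Φ^[n + 1] v₀ - Φ^[n] v₀ ∈ fil n := fun n => by
    induction n with
    | zero => simp
    | succ n ih =>
      rw [Function.iterate_succ_apply', Function.iterate_succ_apply' Φ n]
      exact hc n _ (by simpa only [Function.iterate_succ_apply'] using hmem (n + 1)) _ (hmem n)
        (by simpa only [Function.iterate_succ_apply'] using ih)
  obtain ⟨v, hv⟩ := complete (fun n => Φ^[n] v₀) hstep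
  have hvP : v ∈ P := hP v fun n => ⟨_, hmem n, hv n⟩
  refine ⟨v, hvP, eq_of_sub_mem fun n => ?_⟩
  have h1 := fil_succ_le _ (hc n v hvP _ (hmem n) (hv n))
  rw [← Function.iterate_succ_apply' Φ] at h1
  convert (fil n).sub_mem h1 (fil_succ_le _ (hv (n + 1))) using 1
  abel

/-- The linear map `T` raises the filtration by `j`. -/
def RaisesBy (j : ℕ) (T : M →ₗ[ℝ] M') : Prop := ∀ n v, v ∈ fil n → T v ∈ fil (n + j)

namespace RaisesBy

variable {i j : ℕ} {S T : M →ₗ[ℝ] M'}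

theorem add (hS : RaisesBy j S) (hT : RaisesBy j T) : RaisesBy j (S + T) :=
  fun n v hv => Submodule.add_mem _ (hS n v hv) (hT n v hv)

theorem sub (hS : RaisesBy j S) (hT : RaisesBy j T) : RaisesBy j (S - T) :=
  fun n v hv => Submodule.sub_mem _ (hS n v hv) (hT n v hv)

theorem neg (hT : RaisesBy j T) : RaisesBy j (-T) :=
  fun n v hv => Submodule.neg_mem _ (hT n v hv)

theorem mono (h : i ≤ j) (hT : RaisesBy j T) : RaisesBy i T :=
  fun n v hv => fil_mono (by omega) (hT n v hv)

theorem comp {R : M' →ₗ[ℝ] M''} (hR : RaisesBy i R) (hT : RaisesBy j T) :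
    RaisesBy (i + j) (R ∘ₗ T) :=
  fun n v hv => by
    have := hR _ _ (hT n v hv)
    rwa [add_assoc, add_comm j i] at this

theorem eq_zero (h : ∀ j, RaisesBy j T) : T = 0 :=
  LinearMap.ext fun v => eq_zero_of_mem _ fun n => by
    simpa using h n 0 v (mem_fil_zero v)

theorem one : RaisesBy 0 (1 : Module.End ℝ M) := fun _ _ hv => hv

theorem mul {R T : Module.End ℝ M} (hR : RaisesBy i R) (hT : RaisesBy j T) :
    RaisesBy (i + j) (R * T) := hR.comp hT

theorem pow {T : Module.End ℝ M} (hT : RaisesBy j T) (k : ℕ) : RaisesBy (k * j) (T ^ k) := by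
  induction k with
  | zero => simpa using one
  | succ k ih =>
    rw [pow_succ, Nat.succ_mul]
    exact ih.mul hT

theorem pow_one {T : Module.End ℝ M} (hT : RaisesBy 1 T) (k : ℕ) : RaisesBy k (T ^ k) := by
  simpa using hT.pow k

theorem pow_mem {T : Module.End ℝ M} (hT : RaisesBy 1 T) (k : ℕ) (v : M) : (T ^ k) v ∈ fil k := by
  simpa using hT.pow_one k 0 v (mem_fil_zero v)

/-- If two operators of order one differ at order `n`, so do their powers, at an order that
increases with the exponent. -/
theorem pow_sub_pow {S T : Module.End ℝ M} (hS : RaisesBy 1 S) (hT : RaisesBy 1 T) {n : ℕ}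
    (h : RaisesBy n (S - T)) (k : ℕ) : RaisesBy (n + k) (S ^ (k + 1) - T ^ (k + 1)) := by
  induction k with
  | zero => simpa using h
  | succ k ih =>
    have e : S ^ (k + 1 + 1) - T ^ (k + 1 + 1)
        = S * (S ^ (k + 1) - T ^ (k + 1)) + (S - T) * T ^ (k + 1) := by
      rw [pow_succ' S, pow_succ' T]
      noncomm_ring
    rw [e]
    exact ((hS.mul ih).mono (by omega)).add ((h.mul (hT.pow_one (k + 1))).mono (by omega))

end RaisesBy

/-! ### Power series, in particular exponentials, of operators that raise the filtration -/

section Series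

variable {T : Module.End ℝ M} (hT : RaisesBy 1 T)

include hT in
theorem exists_series (f : PowerSeries ℝ) (v : M) :
    ∃ w, SumsTo (fun k => f.coeff k • (T ^ k) v) w :=
  exists_sumsTo fun k => Submodule.smul_mem _ _ (hT.pow_mem k v)

/-- The value of a power series at an operator that raises the filtration. -/
def seriesEnd (f : PowerSeries ℝ) : Module.End ℝ M :=
  have spec (v : M) : SumsTo (fun k => f.coeff k • (T ^ k) v) (exists_series hT f v).choose :=
    (exists_series hT f v).choose_spec
  { toFun := fun v => (exists_series hT f v).choose
    map_add' := fun v w => (spec (v + w)).unique <| by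
      simpa only [map_add, smul_add] using (spec v).add (spec w)
    map_smul' := fun c v => (spec (c • v)).unique <| by
      simpa only [map_smul, smul_comm c, RingHom.id_apply] using (spec v).smul c }

theorem seriesEnd_sumsTo (f : PowerSeries ℝ) (v : M) :
    SumsTo (fun k => f.coeff k • (T ^ k) v) (seriesEnd hT f v) :=
  (exists_series hT f v).choose_spec

/-- Evaluation of power series at an operator that raises the filtration, as a morphism of
algebras. -/
def series : PowerSeries ℝ →ₐ[ℝ] Module.End ℝ M :=
  AlgHom.ofLinearMap
    { toFun := seriesEnd hT
      map_add' := fun f g => LinearMap.ext fun v => (seriesEnd_sumsTo hT (f + g) v).unique <| by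
        simpa only [map_add, add_smul, LinearMap.add_apply] using
          (seriesEnd_sumsTo hT f v).add (seriesEnd_sumsTo hT g v)
      map_smul' := fun c f => LinearMap.ext fun v => (seriesEnd_sumsTo hT (c • f) v).unique <| by
        simpa only [map_smul, smul_smul, smul_eq_mul, LinearMap.smul_apply, RingHom.id_apply] using
          (seriesEnd_sumsTo hT f v).smul c }
    (LinearMap.ext fun v => (seriesEnd_sumsTo hT 1 v).unique <| by
      intro m
      rcases m with _ | m
      · simp
      · simp [PowerSeries.coeff_one])
    (fun f g => LinearMap.ext fun v => (seriesEnd_sumsTo hT (f * g) v).unique <| by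
      have := (seriesEnd_sumsTo hT f (seriesEnd hT g v)).diag
        (w := fun i j => f.coeff i • g.coeff j • (T ^ (i + j)) v) ?_
      · change SumsTo _ (seriesEnd hT f (seriesEnd hT g v))
        convert this using 2 with n
        rw [PowerSeries.coeff_mul, Finset.sum_smul]
        refine Finset.sum_congr rfl fun p hp => ?_
        rw [smul_smul, mem_antidiagonal.1 hp]
      · intro i m
        have h := hT.pow_one i _ _ (seriesEnd_sumsTo hT g v m)
        rw [add_comm] at h
        convert Submodule.smul_mem _ (f.coeff i) h using 1
        simp only [map_sub, map_sum, smul_sub, Finset.smul_sum, map_smul, pow_add,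
          Module.End.mul_apply])

theorem series_sumsTo (f : PowerSeries ℝ) (v : M) :
    SumsTo (fun k => f.coeff k • (T ^ k) v) (series hT f v) :=
  (exists_series hT f v).choose_spec

theorem series_raisesBy {f : PowerSeries ℝ} {n : ℕ} (hf : ∀ k < n, f.coeff k = 0) :
    RaisesBy n (series hT f) := fun m v hv => by
  have h := series_sumsTo hT f v (m + n)
  have h2 : ∑ k ∈ Finset.range (m + n), f.coeff k • (T ^ k) v ∈ fil (m + n) := by
    refine Submodule.sum_mem _ fun k _ => ?_
    by_cases hk : k < n
    · simp [hf k hk]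
    · exact Submodule.smul_mem _ _ (fil_mono (by omega) (hT.pow_one k m v hv))
  simpa using (fil (m + n)).add_mem h h2

/-- The exponential of an operator that raises the filtration. -/
def expOp : Module.End ℝ M := series hT (PowerSeries.exp ℝ)

theorem coeff_exp_real (n : ℕ) : (PowerSeries.exp ℝ).coeff n = (n ! : ℝ)⁻¹ := by
  simp [PowerSeries.coeff_exp]

theorem expOp_sumsTo (v : M) : SumsTo (fun k => (k ! : ℝ)⁻¹ • (T ^ k) v) (expOp hT v) := by
  simpa only [coeff_exp_real, expOp] using series_sumsTo hT (PowerSeries.exp ℝ) v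

/-- This is the identity exp(s) exp(-s) = 1 of formal power series, carried over by the algebra
morphism `series`. -/
theorem expOp_mul_expOp_neg : expOp hT * expOp hT.neg = 1 := by
  have h : expOp hT.neg = series hT (PowerSeries.evalNegHom (PowerSeries.exp ℝ)) :=
    LinearMap.ext fun v => (expOp_sumsTo hT.neg v).unique <| by
      have := series_sumsTo hT (PowerSeries.evalNegHom (PowerSeries.exp ℝ)) v
      convert this using 2 with k
      rw [PowerSeries.evalNegHom, PowerSeries.coeff_rescale, coeff_exp_real, neg_pow T,
        mul_comm, mul_smul]
      congr 1
      rcases Nat.even_or_odd k with hk | hk <;> simp [hk.neg_one_pow]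
  rw [h, expOp, ← map_mul, PowerSeries.exp_mul_exp_neg_eq_one, map_one]

theorem expOp_raisesBy : RaisesBy 0 (expOp hT) := series_raisesBy hT (by simp)

/-- Two exponentials whose exponents differ at order `n` have the same leading difference. -/
theorem expOp_sub_expOp {S : Module.End ℝ M} (hS : RaisesBy 1 S) {n : ℕ}
    (h : RaisesBy n (S - T)) : RaisesBy (n + 1) (expOp hS - expOp hT - (S - T)) := by
  intro m v hv
  -- The terms k = 0 cancel and the terms k = 1 give S - T; from k = 2 on, the powers differ at
  -- order n + 1 or higher.
  have key : ∀ i, ∑ k ∈ Finset.range (i + 2), ((k ! : ℝ)⁻¹ • (S ^ k) v - (k ! : ℝ)⁻¹ • (T ^ k) v)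
      - (S - T) v ∈ fil (m + (n + 1)) := by
    intro i
    rw [Finset.sum_range_succ', Finset.sum_range_succ']
    simp only [zero_add, Nat.factorial_one, Nat.cast_one, inv_one, one_smul, _root_.pow_one,
      pow_zero, sub_self, add_zero, Nat.factorial_zero, LinearMap.sub_apply, add_sub_cancel_right]
    refine Submodule.sum_mem _ fun k _ => ?_
    rw [← smul_sub]
    refine Submodule.smul_mem _ _ (fil_mono ?_ (hS.pow_sub_pow hT h (k + 1) m v hv))
    omega
  have h1 := expOp_sumsTo hS v (m + n + 2)
  have h2 := expOp_sumsTo hT v (m + n + 2)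
  have h3 := fil_mono (show m + (n + 1) ≤ m + n + 2 by omega) (Submodule.sub_mem _ h1 h2)
  convert Submodule.add_mem _ h3 (key (m + n)) using 1
  rw [Finset.sum_sub_distrib]
  simp only [LinearMap.sub_apply]
  abel

/-- By `expOp_sub_expOp`, equal exponentials allow an improvement from S - T of order n to order n +
1; since the filtration is separated, S - T vanishes. -/
theorem expOp_injective {S : Module.End ℝ M} (hS : RaisesBy 1 S) (h : expOp hS = expOp hT) :
    S = T := by
  refine sub_eq_zero.1 (RaisesBy.eq_zero fun n => ?_)
  induction n with
  | zero => exact (hS.sub hT).mono (by omega)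
  | succ n ih =>
    have := (expOp_sub_expOp hT hS ih).neg
    rwa [h, sub_self, zero_sub, neg_neg] at this

end Series

/-! ### Filtrations on products and on formal power series -/

instance {ι : Type*} : FilteredModule (ι → M) where
  fil n := Submodule.pi Set.univ fun _ => fil n
  fil_succ_le n v hv i hi := fil_succ_le n (hv i hi)
  fil_zero := by
    ext v
    simp [fil_zero]
  eq_zero_of_mem v hv := funext fun i => eq_zero_of_mem _ fun n => hv n i trivial
  complete u hu := by
    choose v hv using fun i => complete (fun n => u n i) fun n => hu n i trivial
    exact ⟨v, fun n i _ => hv i n⟩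

theorem mem_fil_pi {ι : Type*} {n : ℕ} {v : ι → M} : v ∈ fil n ↔ ∀ i, v i ∈ fil n :=
  ⟨fun h i => h i trivial, fun h i _ => h i⟩

instance {R : Type*} [Ring R] [Algebra ℝ R] : FilteredModule (PowerSeries R) where
  fil n :=
    { carrier := {f | ∀ i < n, PowerSeries.coeff i f = 0}
      add_mem' := fun hf hg i hi => by rw [map_add, hf i hi, hg i hi, add_zero]
      zero_mem' := fun i _ => by simp
      smul_mem' := fun c f hf i hi => by
        rw [PowerSeries.coeff_smul, hf i hi, smul_zero] }
  fil_succ_le n f hf i hi := hf i (by omega)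
  fil_zero := by
    ext f
    simp
  eq_zero_of_mem f hf := by
    ext n
    simpa using hf (n + 1) n (by omega)
  complete u hu := by
    -- The coefficient of degree n is constant along the sequence from index n + 1 on.
    refine ⟨PowerSeries.mk fun n => PowerSeries.coeff n (u (n + 1)), fun n i hi => ?_⟩
    have : ∀ j, i < j → PowerSeries.coeff i (u j) = PowerSeries.coeff i (u (i + 1)) := by
      intro j hj
      induction j, hj using Nat.le_induction with
      | base => rfl
      | succ j hj ih => rw [← ih]; simpa [sub_eq_zero] using hu j i hj
    rw [map_sub, PowerSeries.coeff_mk, this n hi, sub_self]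

theorem mem_fil_powerSeries {R : Type*} [Ring R] [Algebra ℝ R] {n : ℕ} {f : PowerSeries R} :
    f ∈ fil n ↔ ∀ i < n, PowerSeries.coeff i f = 0 := Iff.rfl

theorem mul_mem_fil {R : Type*} [Ring R] [Algebra ℝ R] {m n : ℕ} {f g : PowerSeries R}
    (hf : f ∈ fil m) (hg : g ∈ fil n) : f * g ∈ fil (m + n) := fun i hi => by
  rw [PowerSeries.coeff_mul]
  refine Finset.sum_eq_zero fun p hp => ?_
  have := mem_antidiagonal.1 hp
  by_cases h : p.1 < m
  · rw [hf _ h, zero_mul]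
  · rw [hg _ (by omega), mul_zero]

/-- The coefficients of the sum of a series of power series are finite sums. -/
theorem SumsTo.coeff {R : Type*} [Ring R] [Algebra ℝ R] {u : ℕ → PowerSeries R}
    {v : PowerSeries R} (h : SumsTo u v) (n : ℕ) :
    PowerSeries.coeff n v = ∑ k ∈ Finset.range (n + 1), PowerSeries.coeff n (u k) := by
  have := h (n + 1) n (by omega)
  rwa [map_sub, map_sum, sub_eq_zero] at this

theorem sumsTo_mk {R : Type*} [Ring R] [Algebra ℝ R] {u : ℕ → PowerSeries R}
    (hu : ∀ k, u k ∈ fil k) :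
    SumsTo u (PowerSeries.mk fun n => ∑ k ∈ Finset.range (n + 1), PowerSeries.coeff n (u k)) := by
  obtain ⟨v, hv⟩ := exists_sumsTo hu
  convert hv
  ext n
  rw [PowerSeries.coeff_mk, hv.coeff]

theorem sumsTo_pi {ι : Type*} {u : ℕ → ι → M} {v : ι → M}
    (h : ∀ i, SumsTo (fun k => u k i) (v i)) : SumsTo u v := fun m => mem_fil_pi.2 fun i => by
  simpa using h i m

end FilteredModule

/-- Reassociation of a threefold sum over decompositions of a natural number. -/
theorem sum_antidiagonal_assoc {N : Type*} [AddCommMonoid N] (n : ℕ) (f : ℕ → ℕ → ℕ → N) :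
    ∑ p ∈ antidiagonal n, ∑ q ∈ antidiagonal p.1, f q.1 q.2 p.2
      = ∑ p ∈ antidiagonal n, ∑ q ∈ antidiagonal p.2, f p.1 q.1 q.2 := by
  rw [Finset.sum_sigma', Finset.sum_sigma']
  refine Finset.sum_nbij' (fun a => ⟨(a.2.1, a.2.2 + a.1.2), (a.2.2, a.1.2)⟩)
    (fun a => ⟨(a.1.1 + a.2.1, a.2.2), (a.1.1, a.2.1)⟩) ?_ ?_ ?_ ?_ ?_
  · rintro ⟨⟨i, j⟩, ⟨k, l⟩⟩ h
    simp only [Finset.mem_sigma, mem_antidiagonal, and_true] at h ⊢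
    omega
  · rintro ⟨⟨i, j⟩, ⟨k, l⟩⟩ h
    simp only [Finset.mem_sigma, mem_antidiagonal, and_true] at h ⊢
    omega
  · rintro ⟨⟨i, j⟩, ⟨k, l⟩⟩ h
    simp only [Finset.mem_sigma, mem_antidiagonal] at h
    simp [h.2]
  · rintro ⟨⟨i, j⟩, ⟨k, l⟩⟩ h
    simp only [Finset.mem_sigma, mem_antidiagonal] at h
    simp [h.2]
  · rintro ⟨⟨i, j⟩, ⟨k, l⟩⟩ h
    rfl

/-! ### Dynkin's form of the Baker-Campbell-Hausdorff series for a bilinear bracket -/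

namespace Dynkin

variable {M : Type*} [AddCommGroup M] [Module ℝ M] (b : M →ₗ[ℝ] M →ₗ[ℝ] M)

/-- Right-nested brackets of a word. -/
def nestedBracket : List M → M
  | [] => 0
  | [w] => w
  | w :: w' :: l => b w (nestedBracket (w' :: l))

theorem nestedBracket_cons (w : M) {l : List M} (hl : l ≠ []) :
    nestedBracket b (w :: l) = b w (nestedBracket b l) := by
  cases l with
  | nil => exact absurd rfl hl
  | cons w' l => rfl

theorem nestedBracket_replicate_append (w : M) (r : ℕ) {l : List M} (hl : l ≠ []) :
    nestedBracket b (List.replicate r w ++ l) = ((b w) ^ r : Module.End ℝ M) (nestedBracket b l) := by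
  induction r with
  | zero => simp
  | succ r ih =>
    rw [List.replicate_succ, List.cons_append, nestedBracket_cons b w (by simp [hl]), ih, pow_succ']
    rfl

variable (x y : M)

/-- The part of degree `m` of `exp (ad x) exp (ad y) - 1`. -/
def adPart (m : ℕ) : Module.End ℝ M :=
  if m = 0 then 0 else
    ∑ p ∈ antidiagonal m, ((p.1 ! : ℝ) * (p.2 ! : ℝ))⁻¹ • ((b x) ^ p.1 * (b y) ^ p.2)

/-- The part of degree `N` of the sum, over `(r₀, s₀), ..., (r_k, s_k)` with `r_i + s_i > 0`,
of `(∏ r_i! s_i!)⁻¹ [x^{r₀} y^{s₀} ... x^{r_k} y^{s_k}]`. -/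
def wordSum : ℕ → ℕ → M
  | 0, N => if N = 0 then 0 else ∑ p ∈ antidiagonal N, ((p.1 ! : ℝ) * (p.2 ! : ℝ))⁻¹ •
      nestedBracket b (List.replicate p.1 x ++ List.replicate p.2 y)
  | k + 1, N => ∑ p ∈ antidiagonal N, adPart b x y p.1 (wordSum k p.2)

omit [Module ℝ M] in
-- The box that bounds the exponents in Dynkin's sum is immaterial as soon as it contains the
-- antidiagonal.
theorem sum_fin_prod_fin {N B : ℕ} (hB : N ≤ B) (g : ℕ → ℕ → M) :
    (∑ q : Fin (B + 1) × Fin (B + 1), if (q.1 : ℕ) + q.2 = N then g q.1 q.2 else 0)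
      = ∑ p ∈ antidiagonal N, g p.1 p.2 := by
  rw [Fintype.sum_prod_type,
    Fin.sum_univ_eq_sum_range (fun i => ∑ j : Fin (B + 1), if i + (j : ℕ) = N then g i j else 0)]
  simp only [fun i => Fin.sum_univ_eq_sum_range (fun j => if i + j = N then g i j else 0) (B + 1)]
  rw [← Finset.sum_product', ← Finset.sum_filter]
  refine Finset.sum_congr ?_ fun _ _ => rfl
  ext ⟨i, j⟩
  simp only [Finset.mem_filter, Finset.mem_product, Finset.mem_range, mem_antidiagonal]
  omega

/-- Splitting off the first block x^r y^s of a word leaves a nonempty word, on whose nested bracket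
the block acts as (ad x)^r (ad y)^s; this is the recursion that defines `wordSum`. The bound B is
kept apart from N because the induction lowers N while the range of the exponents stays fixed. -/
theorem sum_words {B : ℕ} (k : ℕ) : ∀ {N : ℕ}, N ≤ B →
    (∑ p : Fin (k + 1) → Fin (B + 1) × Fin (B + 1) with
        (∀ i, 0 < ((p i).1 : ℕ) + (p i).2) ∧ ∑ i, (((p i).1 : ℕ) + (p i).2) = N,
      (∏ i, ((((p i).1 : ℕ) ! : ℝ) * (((p i).2 : ℕ) ! : ℝ)))⁻¹ •
        nestedBracket b (List.ofFn fun i =>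
          List.replicate ((p i).1 : ℕ) x ++ List.replicate ((p i).2 : ℕ) y).flatten)
      = wordSum b x y k N := by
  induction k with
  | zero =>
    intro N hN
    rw [Finset.sum_filter, ← (Equiv.funUnique (Fin 1) _).symm.sum_comp]
    simp only [Equiv.funUnique_symm_apply, uniqueElim_const, Finset.univ_unique,
      Finset.sum_singleton, Finset.prod_singleton, List.ofFn_succ, List.ofFn_zero,
      List.flatten_cons, List.flatten_nil, List.append_nil, wordSum, Nat.reduceAdd, forall_const]
    split_ifs with h
    · subst h
      refine Finset.sum_eq_zero fun q _ => if_neg ?_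
      omega
    · rw [← sum_fin_prod_fin hN fun i j => ((i ! : ℝ) * (j ! : ℝ))⁻¹ •
        nestedBracket b (List.replicate i x ++ List.replicate j y)]
      refine Finset.sum_congr rfl fun q _ => if_congr ?_ rfl rfl
      omega
  | succ k ih =>
    intro N hN
    have key : ∀ q : Fin (B + 1) × Fin (B + 1),
        (∑ p : Fin (k + 1) → Fin (B + 1) × Fin (B + 1),
          if (0 < (q.1 : ℕ) + q.2 ∧ ∀ i, 0 < ((p i).1 : ℕ) + (p i).2) ∧
              (q.1 : ℕ) + q.2 + ∑ i, (((p i).1 : ℕ) + (p i).2) = N then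
            (((q.1 : ℕ) ! * (q.2 : ℕ)! : ℝ) *
              ∏ i, ((((p i).1 : ℕ) ! : ℝ) * (((p i).2 : ℕ) ! : ℝ)))⁻¹ •
              nestedBracket b (List.replicate (q.1 : ℕ) x ++ List.replicate (q.2 : ℕ) y ++
                (List.ofFn fun i =>
                  List.replicate ((p i).1 : ℕ) x ++ List.replicate ((p i).2 : ℕ) y).flatten)
          else 0)
        = if 0 < (q.1 : ℕ) + q.2 ∧ (q.1 : ℕ) + q.2 ≤ N then
            ((q.1 : ℕ) ! * (q.2 : ℕ)! : ℝ)⁻¹ • ((b x) ^ (q.1 : ℕ) * (b y) ^ (q.2 : ℕ))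
              (wordSum b x y k (N - (q.1 + q.2)))
          else 0 := by
      intro q
      split_ifs with h
      · rw [← ih (N := N - (q.1 + q.2)) (by omega), Finset.sum_filter, map_sum, Finset.smul_sum]
        refine Finset.sum_congr rfl fun p _ => ?_
        by_cases h2 : (∀ i, 0 < ((p i).1 : ℕ) + (p i).2) ∧
            ∑ i, (((p i).1 : ℕ) + (p i).2) = N - (q.1 + q.2)
        · rw [if_pos h2, if_pos ⟨⟨h.1, h2.1⟩, by omega⟩]
          have hl : (List.ofFn fun i => List.replicate ((p i).1 : ℕ) x ++
              List.replicate ((p i).2 : ℕ) y).flatten ≠ [] := by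
            have := h2.1 0
            intro h3
            rw [List.ofFn_succ, List.flatten_cons] at h3
            have := congrArg List.length h3
            simp only [List.length_append, List.length_replicate, List.length_nil] at this
            omega
          rw [List.append_assoc, nestedBracket_replicate_append b x _ (List.append_ne_nil_of_right_ne_nil _ hl),
            nestedBracket_replicate_append b y _ hl, map_smul, smul_smul, mul_inv]
          rfl
        · rw [if_neg h2, if_neg, map_zero, smul_zero]
          rintro ⟨h3, h4⟩
          exact h2 ⟨h3.2, by omega⟩
      · refine Finset.sum_eq_zero fun p _ => if_neg ?_
        rintro ⟨h3, h4⟩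
        exact h ⟨h3.1, by omega⟩
    rw [Finset.sum_filter, ← (Fin.consEquiv fun _ => Fin (B + 1) × Fin (B + 1)).sum_comp,
      Fintype.sum_prod_type]
    simp only [Fin.consEquiv, Equiv.coe_fn_mk, Fin.forall_fin_succ, Fin.sum_univ_succ,
      Fin.prod_univ_succ, Fin.cons_zero, Fin.cons_succ, List.ofFn_succ, List.flatten_cons]
      at key ⊢
    rw [Finset.sum_congr rfl fun q _ => key q, wordSum]
    have h5 : ∀ p ∈ antidiagonal N, adPart b x y p.1 (wordSum b x y k p.2)
        = ∑ q : Fin (B + 1) × Fin (B + 1), if (q.1 : ℕ) + q.2 = p.1 then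
            (if 0 < (q.1 : ℕ) + q.2 then
              ((q.1 : ℕ) ! * (q.2 : ℕ)! : ℝ)⁻¹ • ((b x) ^ (q.1 : ℕ) * (b y) ^ (q.2 : ℕ))
              (wordSum b x y k (N - (q.1 + q.2))) else 0) else 0 := by
      intro p hp
      rw [mem_antidiagonal] at hp
      rw [sum_fin_prod_fin (N := p.1) (by omega) fun i j => if 0 < i + j then
              (i ! * j ! : ℝ)⁻¹ • ((b x) ^ i * (b y) ^ j)
              (wordSum b x y k (N - (i + j))) else 0, adPart]
      split_ifs with h
      · rw [LinearMap.zero_apply]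
        refine (Finset.sum_eq_zero fun q hq => if_neg ?_).symm
        rw [mem_antidiagonal] at hq
        omega
      · rw [LinearMap.sum_apply]
        refine Finset.sum_congr rfl fun q hq => ?_
        rw [mem_antidiagonal] at hq
        rw [if_pos (by omega), hq, ← hp, Nat.add_sub_cancel_left]
        rfl
    rw [Finset.sum_congr rfl h5, Finset.sum_comm]
    refine Finset.sum_congr rfl fun q _ => ?_
    rw [Finset.Nat.sum_antidiagonal_eq_sum_range_succ_mk]
    simp only [Finset.sum_ite_eq, Finset.mem_range, Nat.lt_succ_iff]
    split_ifs <;> first | rfl | omega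

/-- The part of degree `N` of the Baker-Campbell-Hausdorff series in Dynkin's form. -/
def bchPart (N : ℕ) : M :=
  ∑ k ∈ Finset.range N, ((-1 : ℝ) ^ k / ((k + 1) * N)) • wordSum b x y k N

theorem map_nestedBracket {M' : Type*} [AddCommGroup M'] [Module ℝ M']
    (b' : M' →ₗ[ℝ] M' →ₗ[ℝ] M') (L : M →ₗ[ℝ] M') (hL : ∀ v w, L (b v w) = b' (L v) (L w)) :
    ∀ l : List M, L (nestedBracket b l) = nestedBracket b' (l.map L)
  | [] => map_zero L
  | [w] => rfl
  | w :: w' :: l => by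
    rw [nestedBracket, hL, map_nestedBracket b' L hL (w' :: l)]
    rfl

theorem map_wordSum {M' : Type*} [AddCommGroup M'] [Module ℝ M']
    (b' : M' →ₗ[ℝ] M' →ₗ[ℝ] M') (L : M →ₗ[ℝ] M') (hL : ∀ v w, L (b v w) = b' (L v) (L w))
    (k : ℕ) : ∀ N, L (wordSum b x y k N) = wordSum b' (L x) (L y) k N := by
  have hpow : ∀ w v (n : ℕ), L (((b w) ^ n : Module.End ℝ M) v)
      = ((b' (L w)) ^ n : Module.End ℝ M') (L v) := by
    intro w v n
    induction n with
    | zero => rfl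
    | succ n ih => rw [pow_succ', pow_succ', Module.End.mul_apply, hL, ih]; rfl
  induction k with
  | zero =>
    intro N
    rw [wordSum, wordSum]
    split_ifs
    · exact map_zero L
    · simp [map_nestedBracket b b' L hL]
  | succ k ih =>
    intro N
    rw [wordSum, wordSum, map_sum]
    refine Finset.sum_congr rfl fun p _ => ?_
    rw [adPart, adPart]
    split_ifs
    · exact map_zero L
    · simp [LinearMap.sum_apply, map_sum, hpow, ih]

/-- The hypothesis on `L` is only compatibility with the two brackets. A bracket without Jacobi
identity can therefore be compared with a commutator. -/
theorem map_bchPart {M' : Type*} [AddCommGroup M'] [Module ℝ M']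
    (b' : M' →ₗ[ℝ] M' →ₗ[ℝ] M') (L : M →ₗ[ℝ] M') (hL : ∀ v w, L (b v w) = b' (L v) (L w))
    (N : ℕ) : L (bchPart b x y N) = bchPart b' (L x) (L y) N := by
  simp [bchPart, map_wordSum b x y b' L hL]

section Alternating

variable (hb : ∀ v, b v v = 0)
include hb

theorem nestedBracket_replicate_add_two (n : ℕ) :
    nestedBracket b (List.replicate (n + 2) x) = 0 := by
  induction n with
  | zero => exact hb x
  | succ n ih =>
    rw [List.replicate_succ, nestedBracket_cons b x (by simp), ih, map_zero]

/-- A single block x^r y^s with s ≥ 2, or with s = 0 and r ≥ 2, ends in [y, y] or [x, x] and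
contributes nothing. What survives is the expansion of x + exp(ad x) y. -/
theorem wordSum_zero_succ (n : ℕ) : wordSum b x y 0 (n + 1)
    = (if n = 0 then x else 0) + (n ! : ℝ)⁻¹ • ((b x) ^ n : Module.End ℝ M) y := by
  rw [wordSum, if_neg (Nat.succ_ne_zero n), Finset.Nat.sum_antidiagonal_succ']
  congr 1
  · rcases n with _ | n
    · simp [nestedBracket]
    · simp [nestedBracket_replicate_add_two b x hb]
  · rcases n with _ | n
    · simp [nestedBracket]
    · rw [Finset.Nat.sum_antidiagonal_succ', Finset.sum_eq_zero, add_zero]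
      · rw [nestedBracket_replicate_append b x _ (by simp)]
        simp [nestedBracket]
      · intro p _
        rw [nestedBracket_replicate_append b x _ (by simp), nestedBracket_replicate_add_two b y hb]
        simp

theorem bracket_antisymm (v w : M) : b v w = -b w v := by
  have := hb (v + w)
  simp only [map_add, LinearMap.add_apply, hb, zero_add, add_zero] at this
  exact eq_neg_of_add_eq_zero_right this

theorem bchPart_one : bchPart b x y 1 = x + y := by
  simp [bchPart, wordSum_zero_succ b x y hb]

omit hb in
theorem wordSum_succ (k N : ℕ) : wordSum b x y (k + 1) N
    = ∑ p ∈ antidiagonal N, adPart b x y p.1 (wordSum b x y k p.2) := rfl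

theorem bchPart_two : bchPart b x y 2 = (1 / 2 : ℝ) • b x y := by
  have h := bracket_antisymm b hb y x
  have h1 := wordSum_zero_succ b x y hb 0
  have h2 := wordSum_zero_succ b x y hb 1
  have h0 : wordSum b x y 0 0 = 0 := rfl
  norm_num at h1 h2
  simp [bchPart, Finset.sum_range_succ, h0, h1, h2, wordSum_succ, adPart,
    Finset.Nat.sum_antidiagonal_succ, hb, h]

theorem bchPart_three : bchPart b x y 3
    = (1 / 12 : ℝ) • (b x (b x y) + b y (b y x)) := by
  have h := bracket_antisymm b hb y x
  have h1 := wordSum_zero_succ b x y hb 0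
  have h2 := wordSum_zero_succ b x y hb 1
  have h3 := wordSum_zero_succ b x y hb 2
  have h0 : wordSum b x y 0 0 = 0 := rfl
  norm_num at h1 h2 h3
  simp [bchPart, Finset.sum_range_succ, h0, h1, h2, h3, wordSum_succ, adPart,
    Finset.Nat.sum_antidiagonal_succ, hb, h, pow_two]
  module

end Alternating

end Dynkin
open FilteredModule Dynkin

/-! ### Commutator identities in associative algebras, degree by degree -/

section Commutator

variable {A : Type*} [Ring A] [Algebra ℝ A]

/-- The commutator of an associative algebra, as a bilinear map. -/
def commutator₂ (A : Type*) [Ring A] [Algebra ℝ A] : A →ₗ[ℝ] A →ₗ[ℝ] A :=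
  LinearMap.mul ℝ A - (LinearMap.mul ℝ A).flip

@[simp] theorem commutator₂_apply (a b : A) : commutator₂ A a b = a * b - b * a := rfl

/-- Left multiplication by z is the sum of the commuting operators ad z and right multiplication by
z, so the binomial theorem applies. Summed over m, this is e^z s = (e^{ad z} s) e^z. -/
theorem inv_factorial_smul_pow_mul (z s : A) (m : ℕ) :
    (m ! : ℝ)⁻¹ • (z ^ m * s) = ∑ p ∈ antidiagonal m,
      ((p.1 ! : ℝ)⁻¹ • ((commutator₂ A z) ^ p.1 : Module.End ℝ A) s) *
        ((p.2 ! : ℝ)⁻¹ • z ^ p.2) := by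
  have hc : Commute (commutator₂ A z : Module.End ℝ A) (LinearMap.mulRight ℝ z) := by
    refine LinearMap.ext fun s => ?_
    simp only [Module.End.mul_apply, commutator₂_apply, LinearMap.mulRight_apply]
    noncomm_ring
  have hl : LinearMap.mulLeft ℝ z = (commutator₂ A z : Module.End ℝ A) + LinearMap.mulRight ℝ z := by
    refine LinearMap.ext fun s => ?_
    simp
  have h1 : z ^ m * s = ((LinearMap.mulLeft ℝ z) ^ m : Module.End ℝ A) s := by
    rw [LinearMap.pow_mulLeft, LinearMap.mulLeft_apply]
  rw [h1, hl, hc.add_pow', LinearMap.sum_apply, Finset.smul_sum]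
  refine Finset.sum_congr rfl fun p hp => ?_
  have h2 : (m.choose p.1 : ℝ) * p.1 ! * p.2 ! = m ! := by
    rw [← mem_antidiagonal.1 hp, Nat.choose_symm_add]
    exact_mod_cast Nat.add_choose_mul_factorial_mul_factorial p.1 p.2
  rw [LinearMap.smul_apply, hc.pow_pow p.1 p.2 |>.eq, Module.End.mul_apply,
    LinearMap.pow_mulRight, LinearMap.mulRight_apply, ← Nat.cast_smul_eq_nsmul ℝ, smul_smul,
    smul_mul_smul_comm, ← h2]
  congr 1
  have := Nat.cast_ne_zero (R := ℝ).2 (Nat.factorial_ne_zero p.1)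
  have := Nat.cast_ne_zero (R := ℝ).2 (Nat.factorial_ne_zero p.2)
  have hch : (m.choose p.1 : ℝ) ≠ 0 := by
    intro h
    rw [h, zero_mul, zero_mul] at h2
    exact Nat.factorial_ne_zero m (by exact_mod_cast h2.symm)
  field_simp

/-- Summed over m, this is the formula E(e^z) = ((e^{ad z} - 1) / ad z)(E z) e^z for the derivative
of an exponential. -/
theorem derivation_pow_succ (E : A →ₗ[ℝ] A) (hE : ∀ a b, E (a * b) = E a * b + a * E b) (z : A)
    (m : ℕ) : (((m + 1) ! : ℕ) : ℝ)⁻¹ • E (z ^ (m + 1)) = ∑ p ∈ antidiagonal m,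
      ((((p.1 + 1)! : ℕ) : ℝ)⁻¹ • ((commutator₂ A z) ^ p.1 : Module.End ℝ A) (E z)) *
        ((p.2 ! : ℝ)⁻¹ • z ^ p.2) := by
  set c : ℕ → A := fun i =>
    (((i + 1)! : ℕ) : ℝ)⁻¹ • ((commutator₂ A z) ^ i : Module.End ℝ A) (E z) with hc
  set q : ℕ → A := fun j => (j ! : ℝ)⁻¹ • z ^ j with hq
  have hfac : ∀ n : ℕ, ((n + 1 : ℕ) : ℝ) * (((n + 1)! : ℕ) : ℝ)⁻¹ = (n ! : ℝ)⁻¹ := by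
    intro n
    have h1 := Nat.cast_ne_zero (R := ℝ).2 (Nat.factorial_ne_zero n)
    have h2 : ((n + 1 : ℕ) : ℝ) ≠ 0 := by positivity
    rw [Nat.factorial_succ]
    push_cast at h2 ⊢
    field_simp
  have hzq : ∀ j, z * q j = ((j + 1 : ℕ) : ℝ) • q (j + 1) := by
    intro j
    simp only [hq]
    rw [smul_smul, hfac, mul_smul_comm, pow_succ']
  have hzc : ∀ i, z * c i = ((i + 2 : ℕ) : ℝ) • c (i + 1) + c i * z := by
    intro i
    simp only [hc]
    rw [smul_smul, hfac (i + 1), pow_succ', Module.End.mul_apply, commutator₂_apply, smul_sub,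
      mul_smul_comm, smul_mul_assoc, sub_add_cancel]
  change _ = ∑ p ∈ antidiagonal m, c p.1 * q p.2
  induction m with
  | zero => simp [hc, hq]
  | succ m ih =>
    have h2 : ((m + 2 : ℕ) : ℝ) ≠ 0 := by positivity
    -- Multiplication by m + 2 allows the Leibniz rule for z * z^(m+1). On the right the weight m +
    -- 2 splits as (p.1 + 1) + p.2, which matches the two terms produced by moving z past c and into
    -- q; the summand with p.1 = 0 is the term E z * z^(m+1).
    refine (smul_right_injective A h2) ?_
    dsimp only
    rw [smul_smul, hfac (m + 1), pow_succ', hE, smul_add, ← mul_smul_comm _ z (E _), ih,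
      Finset.mul_sum]
    have e1 : ∀ p ∈ antidiagonal m, z * (c p.1 * q p.2)
        = ((p.1 + 2 : ℕ) : ℝ) • (c (p.1 + 1) * q p.2)
          + ((p.2 + 1 : ℕ) : ℝ) • (c p.1 * q (p.2 + 1)) := by
      intro p _
      rw [← mul_assoc, hzc, add_mul, mul_assoc (c p.1), hzq, mul_smul_comm _ (c p.1),
        smul_mul_assoc _ (c _)]
    have e2 : ∀ p ∈ antidiagonal (m + 1), ((m + 2 : ℕ) : ℝ) • (c p.1 * q p.2)
        = ((p.1 + 1 : ℕ) : ℝ) • (c p.1 * q p.2) + (p.2 : ℝ) • (c p.1 * q p.2) := by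
      intro p hp
      rw [← add_smul, ← Nat.cast_add]
      congr 2
      have := mem_antidiagonal.1 hp
      omega
    rw [Finset.sum_congr rfl e1, Finset.sum_add_distrib, Finset.smul_sum, Finset.sum_congr rfl e2,
      Finset.sum_add_distrib, Finset.Nat.sum_antidiagonal_succ,
      Finset.Nat.sum_antidiagonal_succ' (f := fun p => (p.2 : ℝ) • (c p.1 * q p.2))]
    simp only [Nat.cast_zero, zero_smul, zero_add, Nat.cast_one, one_smul]
    have e3 : (((m + 1)! : ℕ) : ℝ)⁻¹ • (E z * z ^ (m + 1)) = c 0 * q (m + 1) := by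
      simp [hc, hq]
    rw [e3]
    abel

end Commutator

/-! ### The logarithm series as an inverse of (e^s - 1) / s -/

section LogSeries

/-- The power series `(e^s - 1) / s`. -/
def expSubOneDiv : PowerSeries ℝ := PowerSeries.mk fun i => (((i + 1)! : ℕ) : ℝ)⁻¹

theorem X_mul_expSubOneDiv : PowerSeries.X * expSubOneDiv = PowerSeries.exp ℝ - 1 := by
  ext n
  rcases n with _ | n
  · simp
  · rw [PowerSeries.coeff_succ_X_mul, expSubOneDiv, PowerSeries.coeff_mk, map_sub, coeff_exp_real,
      PowerSeries.coeff_one, if_neg (Nat.succ_ne_zero n), sub_zero]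

theorem coeff_exp_sub_one_pow {n k : ℕ} (h : n < k) :
    ((PowerSeries.exp ℝ - 1) ^ k).coeff n = 0 := by
  rw [← X_mul_expSubOneDiv, mul_pow, PowerSeries.coeff_X_pow_mul', if_neg (by omega)]

/-- `log (1 + u) / u` at `u = e^s - 1` is the inverse of `(e^s - 1) / s`. -/
theorem coeff_one_sub_log_mul {K j : ℕ} (hj : j < K) :
    (1 - (∑ k ∈ Finset.range K, ((-1 : ℝ) ^ k / (k + 1)) • (PowerSeries.exp ℝ - 1) ^ k)
      * expSubOneDiv).coeff j = 0 := by
  set u : PowerSeries ℝ := PowerSeries.exp ℝ - 1 with hu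
  set P : PowerSeries ℝ := PowerSeries.X -
    ∑ k ∈ Finset.range K, ((-1 : ℝ) ^ k / (k + 1)) • u ^ (k + 1) with hP
  have h1 : PowerSeries.X * (1 - (∑ k ∈ Finset.range K, ((-1 : ℝ) ^ k / (k + 1)) • u ^ k)
      * expSubOneDiv) = P := by
    rw [mul_sub, mul_one, mul_left_comm, X_mul_expSubOneDiv, Finset.sum_mul, hP]
    simp only [smul_mul_assoc, ← hu, ← pow_succ]
  -- Since u' = 1 + u, the derivative of the truncated logarithm of 1 + u is a geometric sum and
  -- telescopes; the remainder (-u)^K starts in degree K.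
  have h2 : PowerSeries.derivative ℝ P = (-u) ^ K := by
    have hu' : PowerSeries.derivative ℝ u = 1 + u := by
      rw [hu, map_sub, PowerSeries.derivative_exp, PowerSeries.derivative_one]
      ring
    have h3 : ∀ k ∈ Finset.range K, PowerSeries.derivative ℝ
        (((-1 : ℝ) ^ k / (k + 1)) • u ^ (k + 1)) = (-u) ^ k * (1 - (-u)) := by
      intro k _
      rw [Derivation.map_smul, Derivation.leibniz_pow, hu', ← Nat.cast_smul_eq_nsmul ℝ, smul_smul,
        neg_pow u, sub_neg_eq_add, Nat.add_sub_cancel, smul_eq_mul]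
      have : ((k : ℝ) + 1) ≠ 0 := by positivity
      push_cast
      rw [div_mul_cancel₀ _ this, mul_assoc, ← smul_mul_assoc]
      rcases Nat.even_or_odd k with hk | hk <;> simp [hk.neg_one_pow]
    rw [hP, map_sub, PowerSeries.derivative_X, map_sum, Finset.sum_congr rfl h3, ← Finset.sum_mul,
      geom_sum_mul_neg]
    ring
  have h4 : PowerSeries.coeff (j + 1) P = 0 := by
    have h5 := congrArg (PowerSeries.coeff j) h2
    rw [PowerSeries.coeff_derivative, neg_pow u] at h5
    have h6 : PowerSeries.coeff j ((-1) ^ K * u ^ K) = 0 := by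
      rcases Nat.even_or_odd K with hk | hk <;>
        simp [hk.neg_one_pow, hu, coeff_exp_sub_one_pow hj]
    rw [h6] at h5
    exact (mul_eq_zero.1 h5).resolve_right (by positivity)
  rw [← PowerSeries.coeff_succ_X_mul, h1, h4]

end LogSeries

/-! ### The Baker-Campbell-Hausdorff theorem for formal power series -/

section FormalBCH

variable {R : Type*} [Ring R] [Algebra ℝ R]

theorem mulLeft_raisesBy {Z : PowerSeries R} {n : ℕ} (hZ : Z ∈ fil n) :
    RaisesBy n (LinearMap.mulLeft ℝ Z) := fun m v hv => by
  rw [add_comm]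
  exact mul_mem_fil hZ hv

theorem commutator₂_raisesBy {Z : PowerSeries R} {n : ℕ} (hZ : Z ∈ fil n) :
    RaisesBy n (commutator₂ (PowerSeries R) Z) := fun m v hv => by
  refine Submodule.sub_mem _ ?_ (mul_mem_fil hv hZ)
  rw [add_comm]
  exact mul_mem_fil hZ hv

/-- The exponential of a formal power series without constant term. -/
def expPS (Z : PowerSeries R) : PowerSeries R :=
  PowerSeries.mk fun n => ∑ k ∈ Finset.range (n + 1), PowerSeries.coeff n ((k ! : ℝ)⁻¹ • Z ^ k)

theorem pow_mem_fil {Z : PowerSeries R} (hZ : Z ∈ fil 1) (k : ℕ) : Z ^ k ∈ fil k := by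
  have := (mulLeft_raisesBy hZ).pow_mem k 1
  rwa [LinearMap.pow_mulLeft, LinearMap.mulLeft_apply, mul_one] at this

theorem expPS_sumsTo {Z : PowerSeries R} (hZ : Z ∈ fil 1) :
    SumsTo (fun k => (k ! : ℝ)⁻¹ • Z ^ k) (expPS Z) :=
  sumsTo_mk fun k => Submodule.smul_mem _ _ (pow_mem_fil hZ k)

theorem expOp_mulLeft {Z : PowerSeries R} (hZ : Z ∈ fil 1) (s : PowerSeries R) :
    expOp (mulLeft_raisesBy hZ) s = expPS Z * s := by
  refine (expOp_sumsTo _ s).unique ?_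
  have := (expPS_sumsTo hZ).map (LinearMap.mulRight ℝ s) fun n v hv => by
    simpa using mul_mem_fil hv (mem_fil_zero s)
  simpa only [LinearMap.mulRight_apply, smul_mul_assoc, LinearMap.pow_mulLeft,
    LinearMap.mulLeft_apply] using this

theorem expPS_mul_expPS_neg {Z : PowerSeries R} (hZ : Z ∈ fil 1) : expPS Z * expPS (-Z) = 1 := by
  have hZ' : -Z ∈ fil 1 := Submodule.neg_mem _ hZ
  have h := congrArg (fun T => T 1) (expOp_mul_expOp_neg (mulLeft_raisesBy hZ))
  have h2 : expOp (mulLeft_raisesBy hZ).neg = expOp (mulLeft_raisesBy hZ') := by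
    congr 1
    ext s
    simp
  rwa [h2, Module.End.mul_apply, expOp_mulLeft hZ', expOp_mulLeft hZ, mul_one] at h

/-- Conjugation by e^Z is e^{ad Z}: the Cauchy product on the left is, degree by degree,
`inv_factorial_smul_pow_mul`. -/
theorem expOp_commutator₂_mul {Z : PowerSeries R} (hZ : Z ∈ fil 1) (s : PowerSeries R) :
    expOp (commutator₂_raisesBy hZ) s * expPS Z = expPS Z * s := by
  have h := (expOp_sumsTo (commutator₂_raisesBy hZ) s).conv (expPS_sumsTo hZ)
    (LinearMap.mul ℝ (PowerSeries R)) fun i j v w hv hw => mul_mem_fil hv hw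
  refine h.unique ?_
  rw [← expOp_mulLeft hZ]
  convert expOp_sumsTo (mulLeft_raisesBy hZ) s using 2 with m
  rw [LinearMap.pow_mulLeft, LinearMap.mulLeft_apply, inv_factorial_smul_pow_mul]
  rfl

/-- The derivation `t d/dt`. -/
def eulerOp (R : Type*) [Ring R] [Algebra ℝ R] : PowerSeries R →ₗ[ℝ] PowerSeries R where
  toFun f := PowerSeries.mk fun n => (n : ℝ) • PowerSeries.coeff n f
  map_add' f g := by ext n; simp
  map_smul' c f := by ext n; simp [smul_comm c]

theorem coeff_eulerOp (f : PowerSeries R) (n : ℕ) :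
    PowerSeries.coeff n (eulerOp R f) = (n : ℝ) • PowerSeries.coeff n f := by
  simp [eulerOp]

theorem eulerOp_mul (f g : PowerSeries R) :
    eulerOp R (f * g) = eulerOp R f * g + f * eulerOp R g := by
  ext n
  rw [coeff_eulerOp, map_add, PowerSeries.coeff_mul, PowerSeries.coeff_mul, PowerSeries.coeff_mul,
    Finset.smul_sum, ← Finset.sum_add_distrib]
  refine Finset.sum_congr rfl fun p hp => ?_
  rw [coeff_eulerOp, coeff_eulerOp, smul_mul_assoc, mul_smul_comm, ← add_smul, ← Nat.cast_add,
    mem_antidiagonal.1 hp]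

theorem eulerOp_raisesBy : RaisesBy 0 (eulerOp R) := fun n f hf i hi => by
  rw [coeff_eulerOp, hf i hi, smul_zero]

/-- The logarithmic derivative of an exponential. -/
theorem eulerOp_expPS {Z : PowerSeries R} (hZ : Z ∈ fil 1) :
    eulerOp R (expPS Z)
      = series (commutator₂_raisesBy hZ) expSubOneDiv (eulerOp R Z) * expPS Z := by
  have h := (series_sumsTo (commutator₂_raisesBy hZ) expSubOneDiv (eulerOp R Z)).conv
    (expPS_sumsTo hZ) (LinearMap.mul ℝ (PowerSeries R)) fun i j v w hv hw => mul_mem_fil hv hw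
  refine SumsTo.unique (fun m => ?_) h
  have h2 := (expPS_sumsTo hZ).map (eulerOp R) eulerOp_raisesBy (m + 1)
  rw [Finset.sum_range_succ'] at h2
  have h3 : eulerOp R (1 : PowerSeries R) = 0 := by
    ext n
    rw [coeff_eulerOp, PowerSeries.coeff_one]
    split_ifs with h <;> simp [h]
  simp only [pow_zero, map_smul, h3, smul_zero, add_zero] at h2
  convert fil_succ_le _ h2 using 2
  refine Finset.sum_congr rfl fun k _ => ?_
  rw [derivation_pow_succ (eulerOp R) eulerOp_mul]
  simp only [expSubOneDiv, PowerSeries.coeff_mk]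
  rfl

/-- The logarithm is obtained without its series: Z ↦ W - e^Z + Z is a contraction, because e^Z -
e^{Z'} equals Z - Z' to leading order. -/
theorem exists_expPS_eq {W : PowerSeries R} (hW : W - 1 ∈ fil 1) : ∃ Z ∈ fil 1, expPS Z = W := by
  have hone : ∀ {Z : PowerSeries R}, Z ∈ fil 1 → expPS Z - 1 ∈ fil 1 := fun hZ => by
    simpa using expPS_sumsTo hZ 1
  have hclosed : ∀ v : PowerSeries R, (∀ n, ∃ u ∈ (fil 1 : Submodule ℝ (PowerSeries R)),
      v - u ∈ fil n) → v ∈ fil 1 := fun v hv => by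
    obtain ⟨u, hu, h⟩ := hv 1
    simpa using Submodule.add_mem _ h hu
  have hmaps : ∀ Z : PowerSeries R, Z ∈ fil 1 → W - expPS Z + Z ∈ fil 1 := fun Z hZ => by
    simpa using Submodule.add_mem _ (Submodule.sub_mem _ hW (hone hZ)) hZ
  have hcontr : ∀ n, ∀ Z ∈ fil 1, ∀ Z' ∈ fil 1, Z - Z' ∈ fil n →
      (W - expPS Z + Z) - (W - expPS Z' + Z') ∈ fil (n + 1) := fun n Z hZ Z' hZ' h => by
    have hr : RaisesBy n (LinearMap.mulLeft ℝ Z - LinearMap.mulLeft ℝ Z') := by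
      convert mulLeft_raisesBy h using 1
      ext s
      simp [sub_mul]
    have := expOp_sub_expOp (mulLeft_raisesBy hZ') (mulLeft_raisesBy hZ) hr 0 1 (mem_fil_zero _)
    rw [LinearMap.sub_apply, LinearMap.sub_apply, LinearMap.sub_apply, expOp_mulLeft hZ,
      expOp_mulLeft hZ', LinearMap.mulLeft_apply, LinearMap.mulLeft_apply, mul_one, mul_one,
      mul_one, mul_one, zero_add] at this
    convert Submodule.neg_mem _ this using 1
    abel
  obtain ⟨Z, hZ, h⟩ := exists_fixedPoint
    ((fil 1 : Submodule ℝ (PowerSeries R)) : Set (PowerSeries R)) (Submodule.zero_mem (fil 1))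
    hclosed (fun Z => W - expPS Z + Z) hmaps hcontr
  refine ⟨Z, hZ, ?_⟩
  rw [add_eq_right, sub_eq_zero] at h
  exact h.symm

variable (x y : R)

theorem C_mul_X_mem : PowerSeries.C x * PowerSeries.X ∈ fil (M := PowerSeries R) 1 := by
  intro i hi
  obtain rfl : i = 0 := by omega
  simp

theorem coeff_expPS_C_mul_X (n : ℕ) :
    PowerSeries.coeff n (expPS (PowerSeries.C x * PowerSeries.X)) = (n ! : ℝ)⁻¹ • x ^ n := by
  rw [expPS, PowerSeries.coeff_mk, Finset.sum_eq_single n]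
  · rw [(PowerSeries.commute_X _).mul_pow, ← map_pow, PowerSeries.coeff_smul,
      PowerSeries.coeff_C_mul, PowerSeries.coeff_X_pow_self, mul_one]
  · intro k _ hk
    rw [(PowerSeries.commute_X _).mul_pow, ← map_pow, PowerSeries.coeff_smul,
      PowerSeries.coeff_C_mul, PowerSeries.coeff_X_pow, if_neg hk.symm, mul_zero, smul_zero]
  · intro h
    exact absurd (Finset.self_mem_range_succ n) h

theorem coeff_commutator₂_pow (s : PowerSeries R) (k n : ℕ) :
    PowerSeries.coeff n (((commutator₂ (PowerSeries R) (PowerSeries.C x * PowerSeries.X)) ^ k :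
      Module.End ℝ (PowerSeries R)) s)
      = if k ≤ n then ((commutator₂ R x) ^ k : Module.End ℝ R) (PowerSeries.coeff (n - k) s)
        else 0 := by
  induction k generalizing n with
  | zero => simp
  | succ k ih =>
    rw [pow_succ', Module.End.mul_apply, commutator₂_apply]
    rcases n with _ | n
    · simp
    · rw [mul_assoc, ← mul_assoc _ (PowerSeries.C x), map_sub, PowerSeries.coeff_C_mul,
        PowerSeries.coeff_succ_X_mul, PowerSeries.coeff_succ_mul_X, PowerSeries.coeff_mul_C, ih]
      by_cases h : k ≤ n
      · rw [if_pos h, if_pos (by omega), pow_succ', Module.End.mul_apply, commutator₂_apply,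
          Nat.add_sub_add_right]
      · rw [if_neg h, if_neg (by omega), mul_zero, zero_mul, sub_zero]

theorem coeff_expOp_commutator₂ (s : PowerSeries R) (n : ℕ) :
    PowerSeries.coeff n (expOp (commutator₂_raisesBy (C_mul_X_mem x)) s)
      = ∑ p ∈ antidiagonal n, (p.1 ! : ℝ)⁻¹ •
        ((commutator₂ R x) ^ p.1 : Module.End ℝ R) (PowerSeries.coeff p.2 s) := by
  rw [(expOp_sumsTo _ s).coeff, Finset.Nat.sum_antidiagonal_eq_sum_range_succ_mk]
  refine Finset.sum_congr rfl fun k hk => ?_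
  rw [PowerSeries.coeff_smul, coeff_commutator₂_pow,
    if_pos (Nat.lt_succ_iff.1 (Finset.mem_range.1 hk))]

/-- The Baker-Campbell-Hausdorff theorem in Dynkin's form, for formal power series. -/
theorem expPS_bchPart :
    PowerSeries.mk (bchPart (commutator₂ R) x y) ∈ fil 1 ∧
    expPS (PowerSeries.mk (bchPart (commutator₂ R) x y))
      = expPS (PowerSeries.C x * PowerSeries.X) * expPS (PowerSeries.C y * PowerSeries.X) := by
  set x' : PowerSeries R := PowerSeries.C x * PowerSeries.X with hx'
  set y' : PowerSeries R := PowerSeries.C y * PowerSeries.X with hy'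
  have hx : x' ∈ fil 1 := C_mul_X_mem x
  have hy : y' ∈ fil 1 := C_mul_X_mem y
  set W := expPS x' * expPS y' with hWdef
  set V := expPS (-y') * expPS (-x') with hVdef
  have hWV : W * V = 1 := by
    rw [hWdef, hVdef, mul_assoc, ← mul_assoc (expPS y'), expPS_mul_expPS_neg hy, one_mul,
      expPS_mul_expPS_neg hx]
  have hW1 : W - 1 ∈ fil 1 := by
    intro i hi
    obtain rfl : i = 0 := by omega
    rw [map_sub, hWdef, PowerSeries.coeff_mul, Finset.Nat.antidiagonal_zero, Finset.sum_singleton,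
      hx', hy', coeff_expPS_C_mul_X, coeff_expPS_C_mul_X]
    simp
  -- Z is some logarithm of e^{xt} e^{yt}; the rest of the proof identifies its coefficients with
  -- Dynkin's.
  obtain ⟨Z, hZ, hZW⟩ := exists_expPS_eq hW1
  have hcancel : ∀ {s t : PowerSeries R}, s * W = t * W → s = t := fun {s t} h => by
    rw [← mul_one s, ← hWV, ← mul_assoc s, h, mul_assoc t, hWV, mul_one]
  have hEexp : ∀ z : R, eulerOp R (expPS (PowerSeries.C z * PowerSeries.X))
      = PowerSeries.C z * PowerSeries.X * expPS (PowerSeries.C z * PowerSeries.X) := by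
    intro z
    ext n
    rw [coeff_eulerOp, coeff_expPS_C_mul_X, mul_assoc, PowerSeries.coeff_C_mul]
    rcases n with _ | n
    · simp
    · rw [PowerSeries.coeff_succ_X_mul, coeff_expPS_C_mul_X, mul_smul_comm, ← pow_succ', smul_smul,
        Nat.factorial_succ]
      congr 1
      have := Nat.cast_ne_zero (R := ℝ).2 (Nat.factorial_ne_zero n)
      push_cast
      field_simp
  have hadx := commutator₂_raisesBy hx
  have hady := commutator₂_raisesBy hy
  have hadZ := commutator₂_raisesBy hZ
  have hAd : ∀ s, expOp hadZ s = expOp hadx (expOp hady s) := fun s => hcancel <| by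
    rw [← hZW, expOp_commutator₂_mul hZ, hZW, hWdef, ← mul_assoc (expOp hadx _),
      expOp_commutator₂_mul hx, mul_assoc, mul_assoc, expOp_commutator₂_mul hy]
  set β := x' + expOp hadx y' with hβ
  -- The logarithmic derivative (t dW/dt) W⁻¹ is computed from W = e^Z and from W = e^{xt} e^{yt}.
  have hlog : series hadZ expSubOneDiv (eulerOp R Z) = β := hcancel <| by
    rw [← hZW, ← eulerOp_expPS hZ, hZW, hWdef, eulerOp_mul, hx', hEexp, ← hx', hy', hEexp, ← hy',
      hβ, add_mul, ← mul_assoc (expOp hadx y'), expOp_commutator₂_mul hx]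
    simp only [mul_assoc]
  have hEZ1 : eulerOp R Z ∈ fil 1 := eulerOp_raisesBy 1 Z hZ
  set U : Module.End ℝ (PowerSeries R) := expOp hadZ - 1 with hU
  have hUs : U = series hadZ (PowerSeries.exp ℝ - 1) := by
    rw [map_sub, map_one]
    rfl
  -- U = e^{ad x'} e^{ad y'} - 1; subtracting 1 is what makes `adPart` vanish in degree 0, i.e. what
  -- imposes r + s > 0 on each block.
  have hcoeffU : ∀ s n, PowerSeries.coeff n (U s)
      = ∑ p ∈ antidiagonal n, adPart (commutator₂ R) x y p.1 (PowerSeries.coeff p.2 s) := by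
    intro s n
    rw [hU, LinearMap.sub_apply, map_sub, hAd, coeff_expOp_commutator₂]
    simp only [coeff_expOp_commutator₂, map_sum, Finset.smul_sum, map_smul]
    rw [← sum_antidiagonal_assoc n fun i j k => (i ! : ℝ)⁻¹ • (j ! : ℝ)⁻¹ •
      ((commutator₂ R x) ^ i : Module.End ℝ R)
        (((commutator₂ R y) ^ j : Module.End ℝ R) (PowerSeries.coeff k s)), sub_eq_iff_eq_add]
    rcases n with _ | n
    · simp [adPart]
    · rw [Finset.Nat.sum_antidiagonal_succ, Finset.Nat.sum_antidiagonal_succ, add_comm]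
      congr 1
      · simp only [adPart, if_neg (Nat.succ_ne_zero _), if_true, LinearMap.zero_apply, zero_add,
          LinearMap.sum_apply, LinearMap.smul_apply, mul_inv, mul_smul, Module.End.mul_apply]
      · simp
  have hcoeffβ : ∀ n, PowerSeries.coeff n β = wordSum (commutator₂ R) x y 0 n := by
    intro n
    rcases n with _ | n
    · rw [hβ, map_add, coeff_expOp_commutator₂]
      simp [hx', hy', wordSum]
    · rw [wordSum_zero_succ _ _ _ fun v => by simp, hβ, map_add, coeff_expOp_commutator₂, hx', hy',
        PowerSeries.coeff_succ_mul_X, PowerSeries.coeff_C]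
      congr 1
      rw [Finset.Nat.sum_antidiagonal_succ', Finset.sum_eq_single (n, 0)]
      · simp
      · rintro ⟨i, j⟩ hp hne
        rw [mem_antidiagonal] at hp
        have : j ≠ 0 := by
          rintro rfl
          exact hne (by simpa using hp)
        simp [PowerSeries.coeff_succ_mul_X, PowerSeries.coeff_C, this]
      · intro h
        exact absurd (mem_antidiagonal.2 (by simp)) h
  have hcoeff : ∀ k n, PowerSeries.coeff n ((U ^ k) β) = wordSum (commutator₂ R) x y k n := by
    intro k
    induction k with
    | zero => simpa using hcoeffβ
    | succ k ih =>
      intro n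
      rw [pow_succ', Module.End.mul_apply, hcoeffU, wordSum_succ]
      exact Finset.sum_congr rfl fun p _ => by rw [ih]
  -- Inverting (e^{ad Z} - 1) / ad Z by the logarithm series in U solves `hlog` for t dZ/dt.
  have hmain : ∀ K, eulerOp R Z - ∑ k ∈ Finset.range K, ((-1 : ℝ) ^ k / (k + 1)) • (U ^ k) β
      ∈ fil (1 + K) := by
    intro K
    have := series_raisesBy hadZ (fun j hj => coeff_one_sub_log_mul (K := K) (j := j) hj) 1 _ hEZ1
    convert this using 1
    rw [map_sub, map_one, map_mul, map_sum, LinearMap.sub_apply, Module.End.mul_apply, hlog,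
      LinearMap.sum_apply, Module.End.one_apply]
    simp only [map_smul, map_pow, ← hUs, LinearMap.smul_apply]
  have hZeq : Z = PowerSeries.mk (bchPart (commutator₂ R) x y) := by
    ext N
    rw [PowerSeries.coeff_mk]
    rcases N with _ | N
    · rw [hZ 0 (by omega)]
      simp [bchPart]
    -- With K = N + 1 the error starts in degree N + 2. The Euler operator multiplies the
    -- coefficient by N + 1, which yields the denominator N + 1 in Dynkin's formula.
    · have h := hmain (N + 1) (N + 1) (by omega)
      rw [map_sub, sub_eq_zero, coeff_eulerOp, map_sum] at h
      have hne : ((N + 1 : ℕ) : ℝ) ≠ 0 := by positivity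
      refine smul_right_injective R hne ?_
      dsimp only
      rw [h, bchPart, Finset.smul_sum]
      refine Finset.sum_congr rfl fun k _ => ?_
      rw [PowerSeries.coeff_smul, hcoeff, smul_smul]
      congr 1
      field_simp
  rw [← hZeq]
  exact ⟨hZ, hZW⟩

end FormalBCH

/-- The Baker-Campbell-Hausdorff theorem in Dynkin's form, for operators that raise the
filtration. -/
theorem expOp_mul_expOp {M : Type*} [AddCommGroup M] [Module ℝ M] [FilteredModule M]
    {S T B : Module.End ℝ M} (hS : RaisesBy 1 S) (hT : RaisesBy 1 T) (hB : RaisesBy 1 B)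
    (hr : ∀ N, RaisesBy N (bchPart (commutator₂ (Module.End ℝ M)) S T N))
    (hsum : ∀ v, SumsTo (fun N => bchPart (commutator₂ (Module.End ℝ M)) S T N v) (B v)) :
    expOp hS * expOp hT = expOp hB := by
  obtain ⟨hZ, hexp⟩ := expPS_bchPart S T
  set Z := PowerSeries.mk (bchPart (commutator₂ (Module.End ℝ M)) S T) with hZdef
  refine LinearMap.ext fun v => ?_
  -- The formal theorem in R[[t]], with R the operators, is specialised to t = 1 by summing
  -- coefficients; the hypothesis `hr` replaces the powers of t as a guarantee of convergence.
  have h1 : SumsTo (fun m => (PowerSeries.coeff m (expPS (PowerSeries.C S * PowerSeries.X) *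
      expPS (PowerSeries.C T * PowerSeries.X)) : Module.End ℝ M) v) ((expOp hS * expOp hT) v) := by
    have := (expOp_sumsTo hS (expOp hT v)).diag
      (w := fun i j => (i ! : ℝ)⁻¹ • (S ^ i) ((j ! : ℝ)⁻¹ • (T ^ j) v)) ?_
    · rw [Module.End.mul_apply]
      convert this using 2 with m
      rw [PowerSeries.coeff_mul, LinearMap.sum_apply]
      refine Finset.sum_congr rfl fun p _ => ?_
      rw [coeff_expPS_C_mul_X, coeff_expPS_C_mul_X]
      rfl
    · intro i m
      have h := hS.pow_one i _ _ (expOp_sumsTo hT v m)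
      rw [add_comm] at h
      convert Submodule.smul_mem _ ((i ! : ℝ)⁻¹) h using 1
      simp only [map_sub, map_sum, smul_sub, Finset.smul_sum]
  have hpow : ∀ k, SumsTo (fun m => (PowerSeries.coeff m (Z ^ k) : Module.End ℝ M) v) ((B ^ k) v) := by
    intro k
    induction k with
    | zero =>
      intro m
      rcases m with _ | m
      · simp
      · rw [Finset.sum_range_succ']
        simp [PowerSeries.coeff_one]
    | succ k ih =>
      rw [pow_succ' B, Module.End.mul_apply]
      have := (hsum ((B ^ k) v)).diag
        (w := fun i j => bchPart (commutator₂ (Module.End ℝ M)) S T i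
          ((PowerSeries.coeff j (Z ^ k) : Module.End ℝ M) v)) ?_
      · convert this using 2 with m
        rw [pow_succ', PowerSeries.coeff_mul, LinearMap.sum_apply]
        refine Finset.sum_congr rfl fun p _ => ?_
        rw [hZdef, PowerSeries.coeff_mk]
        rfl
      · intro i m
        have h := hr i _ _ (ih m)
        rw [add_comm] at h
        simpa only [map_sub, map_sum] using h
  -- The sums over the exponent k and the degree m may be exchanged because Z^k has no terms of
  -- degree below k.
  have h2 := (expOp_sumsTo hB v).swap (w := fun k m => (k ! : ℝ)⁻¹ • (PowerSeries.coeff m (Z ^ k) : Module.End ℝ M) v)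
    (fun k => (hpow k).smul _) fun k m hm => by
      rw [pow_mem_fil hZ k m hm, LinearMap.zero_apply, smul_zero]
  rw [← hexp] at h1
  refine h1.unique ?_
  convert h2 using 2 with m
  rw [expPS, PowerSeries.coeff_mk, LinearMap.sum_apply]
  rfl


/-! ### Algebra of the generalized Lie derivative and the C-bracket -/

namespace FieldAlgebra

variable {D : ℕ} {A : FieldAlgebra D}

theorem sum_swap {N : Type*} [AddCommMonoid N] (f : DIdx D → N) : ∑ P : DIdx D, f P.swap = ∑ P, f P :=
  (Equiv.sumComm (Fin D) (Fin D)).sum_comp f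

theorem contDiff_coe (f : A.toSubalgebra) : ContDiff ℝ ∞ (f : Doubled D → ℝ) := A.smooth f f.2

theorem differentiableAt_coe (f : A.toSubalgebra) (X : Doubled D) :
    DifferentiableAt ℝ (f : Doubled D → ℝ) X :=
  ((contDiff_coe f).differentiable (by simp)).differentiableAt

/-- The partial derivative `∂_M` on the algebra of fields. -/
def pderivA (M : DIdx D) : A.toSubalgebra →ₗ[ℝ] A.toSubalgebra where
  toFun f := ⟨partialD M f, A.partialD_mem f f.2 M⟩
  map_add' f g := by
    ext X
    change fderiv ℝ ((f : Doubled D → ℝ) + (g : Doubled D → ℝ)) X _ = fderiv ℝ f X _ + fderiv ℝ g X _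
    rw [fderiv_add (differentiableAt_coe f X) (differentiableAt_coe g X)]
    rfl
  map_smul' c f := by
    ext X
    change fderiv ℝ (c • (f : Doubled D → ℝ)) X _ = c • fderiv ℝ f X _
    rw [fderiv_const_smul (differentiableAt_coe f X)]
    rfl

theorem coe_pderivA (M : DIdx D) (f : A.toSubalgebra) :
    ((pderivA M f : A.toSubalgebra) : Doubled D → ℝ) = partialD M f := rfl

theorem pderivA_mul (M : DIdx D) (f g : A.toSubalgebra) :
    pderivA M (f * g) = pderivA M f * g + f * pderivA M g := by
  ext X
  change fderiv ℝ ((f : Doubled D → ℝ) * (g : Doubled D → ℝ)) X _ = fderiv ℝ f X _ * g.1 X + f.1 X * fderiv ℝ g X _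
  rw [fderiv_mul (differentiableAt_coe f X) (differentiableAt_coe g X)]
  simp
  ring

theorem pderivA_comm (M N : DIdx D) (f : A.toSubalgebra) :
    pderivA M (pderivA N f) = pderivA N (pderivA M f) := by
  ext X
  have hf : ContDiff ℝ 2 (f : Doubled D → ℝ) := contDiff_infty.1 (contDiff_coe f) 2
  have hsymm := (hf.contDiffAt (x := X)).isSymmSndFDerivAt (by simp)
  have hdiff : DifferentiableAt ℝ (fderiv ℝ (f : Doubled D → ℝ)) X :=
    ((hf.fderiv_right (m := 1) one_add_one_eq_two.le).differentiable (by simp)).differentiableAt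
  have key : ∀ v w : Doubled D, fderiv ℝ (fun Y => fderiv ℝ (f : Doubled D → ℝ) Y v) X w
      = fderiv ℝ (fderiv ℝ (f : Doubled D → ℝ)) X w v := fun v w => by
    rw [fderiv_clm_apply hdiff (differentiableAt_const v)]
    simp
  change fderiv ℝ (fun Y => fderiv ℝ (f : Doubled D → ℝ) Y _) X _
    = fderiv ℝ (fun Y => fderiv ℝ (f : Doubled D → ℝ) Y _) X _
  rw [key, key]
  exact hsymm _ _

theorem pderivA_strong (f g : A.toSubalgebra) : ∑ P, pderivA P.swap f * pderivA P g = 0 := by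
  have := A.grad_mul_grad f f.2 g g.2
  ext X
  have h := congrFun this X
  simpa [Finset.sum_apply, coe_pderivA] using h

theorem coeff_d (M : DIdx D) (f : A.Scalar) (n : ℕ) :
    PowerSeries.coeff n (d M f) = pderivA M (PowerSeries.coeff n f) := PowerSeries.coeff_mk _ _

theorem d_add (M : DIdx D) (f g : A.Scalar) : d M (f + g) = d M f + d M g :=
  PowerSeries.ext fun n => by simp [coeff_d]

theorem d_smul (M : DIdx D) (c : ℝ) (f : A.Scalar) : d M (c • f) = c • d M f :=
  PowerSeries.ext fun n => by simp [coeff_d]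

/-- The partial derivative `∂_M` of scalars as a linear map. -/
def dL (M : DIdx D) : A.Scalar →ₗ[ℝ] A.Scalar where
  toFun := d M
  map_add' := d_add M
  map_smul' := d_smul M

theorem dL_apply (M : DIdx D) (f : A.Scalar) : dL M f = d M f := rfl

theorem d_sub (M : DIdx D) (f g : A.Scalar) : d M (f - g) = d M f - d M g := map_sub (dL M) f g

theorem d_zero (M : DIdx D) : d M (0 : A.Scalar) = 0 := map_zero (dL M)

theorem d_sum {ι : Type*} (M : DIdx D) (s : Finset ι) (f : ι → A.Scalar) :
    d M (∑ i ∈ s, f i) = ∑ i ∈ s, d M (f i) := map_sum (dL M) f s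

theorem d_mul (M : DIdx D) (f g : A.Scalar) : d M (f * g) = d M f * g + f * d M g :=
  PowerSeries.ext fun n => by
    simp [coeff_d, PowerSeries.coeff_mul, pderivA_mul, Finset.sum_add_distrib]

theorem d_comm (M N : DIdx D) (f : A.Scalar) : d M (d N f) = d N (d M f) :=
  PowerSeries.ext fun n => by simp only [coeff_d, pderivA_comm M N]

theorem d_strong (f g : A.Scalar) : ∑ P, d P.swap f * d P g = 0 :=
  PowerSeries.ext fun n => by
    simp only [map_sum, PowerSeries.coeff_mul, coeff_d, map_zero]
    rw [Finset.sum_comm]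
    exact Finset.sum_eq_zero fun p _ => pderivA_strong _ _

theorem transport_add_right (ξ : A.Vec) (f g : A.Scalar) :
    transport ξ (f + g) = transport ξ f + transport ξ g := by
  simp [transport, d_add, mul_add, Finset.sum_add_distrib]

theorem transport_smul_right (ξ : A.Vec) (c : ℝ) (f : A.Scalar) :
    transport ξ (c • f) = c • transport ξ f := by
  simp [transport, d_smul, Finset.smul_sum]

theorem transport_add_left (ξ η : A.Vec) (f : A.Scalar) :
    transport (ξ + η) f = transport ξ f + transport η f := by
  simp [transport, add_mul, Finset.sum_add_distrib]

theorem transport_smul_left (ξ : A.Vec) (c : ℝ) (f : A.Scalar) :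
    transport (c • ξ) f = c • transport ξ f := by
  simp [transport, Finset.smul_sum]

/-- The operator `ξ^P ∂_P` on scalars, as a bilinear map. -/
def transportL : A.Vec →ₗ[ℝ] Module.End ℝ A.Scalar :=
  LinearMap.mk₂ ℝ transport transport_add_left (fun c ξ f => transport_smul_left ξ c f)
    transport_add_right (fun c ξ f => transport_smul_right ξ c f)

theorem transportL_apply (ξ : A.Vec) (f : A.Scalar) : transportL ξ f = transport ξ f := rfl

theorem transport_sum_right {ι : Type*} (ξ : A.Vec) (s : Finset ι) (f : ι → A.Scalar) :
    transport ξ (∑ i ∈ s, f i) = ∑ i ∈ s, transport ξ (f i) := map_sum (transportL ξ) f s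

theorem transport_sub_right (ξ : A.Vec) (f g : A.Scalar) :
    transport ξ (f - g) = transport ξ f - transport ξ g := map_sub (transportL ξ) f g

theorem transport_mul (ξ : A.Vec) (f g : A.Scalar) :
    transport ξ (f * g) = transport ξ f * g + f * transport ξ g := by
  simp only [transport, d_mul, Finset.sum_mul, Finset.mul_sum, ← Finset.sum_add_distrib]
  refine Finset.sum_congr rfl fun P _ => ?_
  ring

theorem d_transport (M : DIdx D) (ξ : A.Vec) (f : A.Scalar) :
    d M (transport ξ f) = (∑ P, d M (ξ P) * d P f) + transport ξ (d M f) := by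
  simp only [transport, d_sum, d_mul, Finset.sum_add_distrib, d_comm M]

/-- The matrix `∂_M ξ^K - ∂^K ξ_M`. -/
def curl (ξ : A.Vec) (M K : DIdx D) : A.Scalar := d M (ξ K) - d K.swap (ξ M.swap)

theorem genLie_apply (ξ V : A.Vec) (M : DIdx D) :
    genLie ξ V M = transport ξ (V M) + ∑ K, curl ξ M K * V K := rfl

theorem transport_gradient (f g : A.Scalar) : transport (fun M => d M.swap f) g = 0 :=
  d_strong f g

/-- The second derivatives of f cancel by symmetry. The correction term of the C-bracket is a
combination of gradients and annihilates f by the strong constraint. -/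
theorem transport_cBracket (ξ η : A.Vec) (f : A.Scalar) :
    transport (cBracket ξ η) f = transport ξ (transport η f) - transport η (transport ξ f) := by
  have h1 : ∀ ξ η : A.Vec, transport ξ (transport η f)
      = transport (fun M => transport ξ (η M)) f + ∑ P, ∑ K, ξ P * η K * d P (d K f) := by
    intro ξ η
    simp only [transport, d_sum, d_mul, Finset.mul_sum, mul_add, Finset.sum_add_distrib,
      Finset.sum_mul]
    congr 1
    · rw [Finset.sum_comm]
      simp only [mul_assoc]
    · simp only [mul_assoc]
  have h2 : ∑ P, ∑ K, ξ P * η K * d P (d K f) = ∑ P, ∑ K, η P * ξ K * d P (d K f) := by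
    rw [Finset.sum_comm]
    refine Finset.sum_congr rfl fun K _ => Finset.sum_congr rfl fun P _ => ?_
    rw [d_comm P, mul_comm (ξ P)]
  set Q : A.Vec := fun M => ∑ P, (ξ P * d M.swap (η P.swap) - η P * d M.swap (ξ P.swap)) with hQ
  have h3 : transport Q f = 0 := by
    simp only [transport, hQ, Finset.sum_mul]
    rw [Finset.sum_comm]
    refine Finset.sum_eq_zero fun P _ => ?_
    simp only [sub_mul, Finset.sum_sub_distrib, mul_assoc, ← Finset.mul_sum, d_strong, mul_zero,
      sub_zero]
  have h4 : cBracket ξ η = (fun M => transport ξ (η M)) + (-1 : ℝ) • (fun M => transport η (ξ M))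
      + (-(1 / 2) : ℝ) • Q := by
    funext M
    simp only [cBracket, Pi.add_apply, Pi.smul_apply, hQ, neg_smul, one_smul]
    ring
  rw [h1, h1, h2, h4, transport_add_left, transport_add_left, transport_smul_left,
    transport_smul_left, h3, smul_zero, neg_smul, one_smul]
  ring

/-- The matrix part of the closure relation. The factor 1/2 makes the correction term of the
C-bracket supply exactly the products ∂_M ξ^P ∂^K η_P of the matrix commutator, and contractions ∂^P
f ∂_P g vanish. -/
theorem curl_cBracket (ξ η : A.Vec) (M K : DIdx D) :
    curl (cBracket ξ η) M K = transport ξ (curl η M K) - transport η (curl ξ M K)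
      + ∑ P, (curl ξ M P * curl η P K - curl η M P * curl ξ P K) := by
  set Q : DIdx D → A.Scalar :=
    fun M => ∑ P, (ξ P * d M.swap (η P.swap) - η P * d M.swap (ξ P.swap)) with hQ
  set Z : A.Scalar := ∑ P, (d M (ξ P) * d K.swap (η P.swap) - d M (η P) * d K.swap (ξ P.swap))
    with hZ
  have hZ' : ∑ P, (d M (ξ P.swap) * d K.swap (η P) - d M (η P.swap) * d K.swap (ξ P)) = Z := by
    rw [hZ, ← sum_swap]
    simp only [Sum.swap_swap]
  have hcurlQ : d M (Q K) - d K.swap (Q M.swap) = 2 * Z := by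
    rw [two_mul]
    nth_rewrite 2 [← hZ']
    simp only [hQ, hZ, d_sum, Sum.swap_swap, ← Finset.sum_sub_distrib, ← Finset.sum_add_distrib,
      d_sub, d_mul]
    refine Finset.sum_congr rfl fun P _ => ?_
    rw [d_comm K.swap M, d_comm K.swap M]
    ring
  have hhalf : (1 / 2 : ℝ) • (d M (Q K) - d K.swap (Q M.swap)) = Z := by
    rw [hcurlQ, two_mul, ← two_smul ℝ, smul_smul]
    norm_num
  have hc : ∀ N, cBracket ξ η N = transport ξ (η N) - transport η (ξ N) - (1 / 2 : ℝ) • Q N :=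
    fun N => rfl
  have hs : ∀ f g : A.Scalar, ∑ P : DIdx D, d P.swap f * d P g = 0 := d_strong
  have e1 : ∀ ξ η : A.Vec, ∑ P : DIdx D, d P.swap (ξ M.swap) * d K.swap (η P.swap)
      = ∑ P : DIdx D, d K.swap (η P) * d P (ξ M.swap) := by
    intro ξ η
    rw [← sum_swap]
    simp only [Sum.swap_swap, mul_comm]
  rw [smul_sub, sub_eq_iff_eq_add] at hhalf
  simp only [curl, hc, d_sub, d_smul, d_transport, transport_sub_right, sub_mul, mul_sub,
    Finset.sum_sub_distrib, hs, e1, hhalf, hZ]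
  ring

/-- Each operator is a derivation plus multiplication by the matrix `curl`, so its commutators are
governed by `transport_cBracket` and `curl_cBracket`. -/
theorem genLie_cBracket (ξ η V : A.Vec) :
    genLie (cBracket ξ η) V = genLie ξ (genLie η V) - genLie η (genLie ξ V) := by
  funext M
  have h : ∀ ξ η : A.Vec, genLie ξ (genLie η V) M = transport ξ (transport η (V M))
      + ∑ K, transport ξ (curl η M K) * V K + ∑ K, (∑ P, curl ξ M P * curl η P K) * V K
      + (∑ K, curl η M K * transport ξ (V K) + ∑ K, curl ξ M K * transport η (V K)) := by
    intro ξ η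
    have h2 : ∑ K, curl ξ M K * ∑ P, curl η K P * V P
        = ∑ K, (∑ P, curl ξ M P * curl η P K) * V K := by
      simp only [Finset.mul_sum, Finset.sum_mul]
      rw [Finset.sum_comm]
      simp only [mul_assoc]
    simp only [genLie_apply, transport_add_right, transport_sum_right, transport_mul, mul_add,
      Finset.sum_add_distrib, h2]
    ring
  rw [Pi.sub_apply, h, h, genLie_apply, transport_cBracket]
  simp only [curl_cBracket, add_mul, sub_mul, Finset.sum_add_distrib, Finset.sum_sub_distrib]
  ring

/-- The transport part vanishes by the strong constraint, the matrix part by the symmetry of second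
derivatives. -/
theorem genLie_gradient (f : A.Scalar) (V : A.Vec) : genLie (fun M => d M.swap f) V = 0 := by
  funext M
  rw [genLie_apply, transport_gradient, zero_add]
  refine Finset.sum_eq_zero fun K _ => ?_
  rw [curl, Sum.swap_swap, d_comm, sub_self, zero_mul]

theorem curl_add (ξ η : A.Vec) (M K : DIdx D) : curl (ξ + η) M K = curl ξ M K + curl η M K := by
  simp only [curl, Pi.add_apply, d_add]
  ring

theorem curl_smul (c : ℝ) (ξ : A.Vec) (M K : DIdx D) : curl (c • ξ) M K = c • curl ξ M K := by
  simp only [curl, Pi.smul_apply, d_smul, smul_sub]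

/-- The generalized Lie derivative as a bilinear map. -/
def genLieL : A.Vec →ₗ[ℝ] Module.End ℝ A.Vec :=
  LinearMap.mk₂ ℝ genLie
    (fun ξ η V => funext fun M => by
      simp only [genLie_apply, Pi.add_apply, transport_add_left, curl_add, add_mul,
        Finset.sum_add_distrib]
      ring)
    (fun c ξ V => funext fun M => by
      simp only [genLie_apply, Pi.smul_apply, transport_smul_left, curl_smul, smul_mul_assoc,
        smul_add, Finset.smul_sum])
    (fun ξ V W => funext fun M => by
      simp only [genLie_apply, Pi.add_apply, transport_add_right, mul_add, Finset.sum_add_distrib]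
      ring)
    (fun c ξ V => funext fun M => by
      simp only [genLie_apply, Pi.smul_apply, transport_smul_right, mul_smul_comm,
        smul_add, Finset.smul_sum])

/-- The C-bracket as a bilinear map. -/
def cBracketL : A.Vec →ₗ[ℝ] A.Vec →ₗ[ℝ] A.Vec :=
  have hanti : ∀ ξ η : A.Vec, cBracket ξ η = -cBracket η ξ := fun ξ η => funext fun M => by
    simp only [cBracket, Pi.neg_apply, Finset.sum_sub_distrib, smul_sub]
    abel
  have hadd : ∀ ξ η ζ : A.Vec, cBracket ξ (η + ζ) = cBracket ξ η + cBracket ξ ζ :=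
    fun ξ η ζ => funext fun M => by
      simp only [cBracket, Pi.add_apply, transport_add_right, transport_add_left, d_add, mul_add,
        add_mul, Finset.sum_sub_distrib, Finset.sum_add_distrib, smul_sub, smul_add]
      abel
  have hsmul : ∀ (c : ℝ) (ξ η : A.Vec), cBracket ξ (c • η) = c • cBracket ξ η :=
    fun c ξ η => funext fun M => by
      simp only [cBracket, Pi.smul_apply, transport_smul_right, transport_smul_left, d_smul,
        mul_smul_comm, smul_mul_assoc, Finset.sum_sub_distrib, ← Finset.smul_sum, smul_sub,
        smul_comm (1 / 2 : ℝ) c]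
  LinearMap.mk₂ ℝ cBracket
    (fun ξ η ζ => by rw [hanti, hadd, hanti ξ, hanti η, neg_add])
    (fun c ξ η => by rw [hanti, hsmul, hanti ξ, smul_neg]) hadd hsmul

theorem cBracketL_apply (ξ η : A.Vec) : cBracketL ξ η = cBracket ξ η := rfl

theorem cBracketL_self (ξ : A.Vec) : cBracketL ξ ξ = 0 := funext fun M => by
  simp [cBracketL_apply, cBracket]

theorem d_mem_fil (M : DIdx D) {f : A.Scalar} {n : ℕ} (hf : f ∈ fil n) : d M f ∈ fil n :=
  fun i hi => by rw [coeff_d, hf i hi, map_zero]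

theorem transport_mem_fil {ξ : A.Vec} {f : A.Scalar} {m n : ℕ} (hξ : ξ ∈ fil m) (hf : f ∈ fil n) :
    transport ξ f ∈ fil (m + n) :=
  Submodule.sum_mem _ fun P _ => mul_mem_fil (mem_fil_pi.1 hξ P) (d_mem_fil P hf)

theorem genLie_mem_fil {ξ V : A.Vec} {m n : ℕ} (hξ : ξ ∈ fil m) (hV : V ∈ fil n) :
    genLie ξ V ∈ fil (m + n) := mem_fil_pi.2 fun M =>
  Submodule.add_mem _ (transport_mem_fil hξ (mem_fil_pi.1 hV M)) <|
    Submodule.sum_mem _ fun K _ => mul_mem_fil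
      (Submodule.sub_mem _ (d_mem_fil _ (mem_fil_pi.1 hξ _)) (d_mem_fil _ (mem_fil_pi.1 hξ _)))
      (mem_fil_pi.1 hV K)

theorem cBracket_mem_fil {ξ η : A.Vec} {m n : ℕ} (hξ : ξ ∈ fil m) (hη : η ∈ fil n) :
    cBracket ξ η ∈ fil (m + n) := mem_fil_pi.2 fun M => by
  have hξ' := mem_fil_pi.1 hξ
  have hη' := mem_fil_pi.1 hη
  refine Submodule.sub_mem _ (Submodule.sub_mem _ (transport_mem_fil hξ (hη' M)) ?_)
    (Submodule.smul_mem _ _ (Submodule.sum_mem _ fun P _ => Submodule.sub_mem _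
      (mul_mem_fil (hξ' P) (d_mem_fil _ (hη' _))) ?_))
  · rw [add_comm]
    exact transport_mem_fil hη (hξ' M)
  · rw [add_comm]
    exact mul_mem_fil (hη' P) (d_mem_fil _ (hξ' _))

theorem transportL_raisesBy {ξ : A.Vec} {m : ℕ} (hξ : ξ ∈ fil m) : RaisesBy m (transportL ξ) :=
  fun n f hf => by
    rw [add_comm]
    exact transport_mem_fil hξ hf

theorem genLieL_raisesBy {ξ : A.Vec} {m : ℕ} (hξ : ξ ∈ fil m) : RaisesBy m (genLieL ξ) :=
  fun n V hV => by
    rw [add_comm]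
    exact genLie_mem_fil hξ hV

theorem isParam_iff {ξ : A.Vec} : IsParam ξ ↔ ξ ∈ fil 1 := by
  rw [mem_fil_pi]
  refine forall_congr' fun M => ?_
  rw [mem_fil_powerSeries]
  constructor
  · intro h i hi
    obtain rfl : i = 0 := by omega
    simpa using h
  · intro h
    simpa using h 0 (by omega)

theorem expScalar_eq {T : Module.End ℝ A.Scalar} (hT : RaisesBy 1 T) (f : A.Scalar) :
    expScalar T f = expOp hT f := by
  refine SumsTo.unique ?_ (expOp_sumsTo hT f)
  have h := sumsTo_mk (u := fun k => (k ! : ℝ)⁻¹ • (T ^ k) f)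
    (fun k => Submodule.smul_mem _ _ (hT.pow_mem k f))
  simp only [PowerSeries.coeff_smul, Module.End.pow_apply] at h ⊢
  exact h

theorem expVec_eq {T : Module.End ℝ A.Vec} (hT : RaisesBy 1 T) (V : A.Vec) :
    expVec T V = expOp hT V := by
  refine SumsTo.unique (sumsTo_pi fun M => ?_) (expOp_sumsTo hT V)
  have h := sumsTo_mk (u := fun k => (k ! : ℝ)⁻¹ • (T ^ k) V M)
    (fun k => Submodule.smul_mem _ _ (mem_fil_pi.1 (hT.pow_mem k V) M))
  simp only [PowerSeries.coeff_smul, Module.End.pow_apply] at h ⊢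
  exact h

theorem largeG_apply {ξ : A.Vec} (hξ : ξ ∈ fil 1) (V : A.Vec) (M : DIdx D) :
    largeG ξ V M = expOp (transportL_raisesBy (Submodule.neg_mem _ hξ))
      (expOp (genLieL_raisesBy hξ) V M) := by
  rw [← expScalar_eq, ← expVec_eq]
  rfl

end FieldAlgebra

theorem expOp_congr {M : Type*} [AddCommGroup M] [Module ℝ M] [FilteredModule M]
    {S T : Module.End ℝ M} (hS : RaisesBy 1 S) (hT : RaisesBy 1 T) (h : S = T) :
    expOp hS = expOp hT := by
  subst h
  rfl

theorem expOp_of_eq_zero {M : Type*} [AddCommGroup M] [Module ℝ M] [FilteredModule M]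
    {T : Module.End ℝ M} (hT : RaisesBy 1 T) (h : T = 0) : expOp hT = 1 := by
  subst h
  refine LinearMap.ext fun v => (expOp_sumsTo hT v).unique fun m => ?_
  rcases m with _ | m
  · simp
  · simp [Finset.sum_range_succ']

/-- The Baker-Campbell-Hausdorff theorem for a bilinear bracket that is represented by
commutators of operators. -/
theorem expOp_mul_expOp_of_bracket {V M : Type*} [AddCommGroup V] [Module ℝ V] [FilteredModule V]
    [AddCommGroup M] [Module ℝ M] [FilteredModule M] (b : V →ₗ[ℝ] V →ₗ[ℝ] V)
    (L : V →ₗ[ℝ] Module.End ℝ M) (hL : ∀ v w x, L (b v w) x = L v (L w x) - L w (L v x))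
    (hr : ∀ {n : ℕ} {v : V}, v ∈ fil n → RaisesBy n (L v)) {v w z : V} (hb : ∀ N, bchPart b v w N ∈ fil N)
    (hz : SumsTo (fun N => bchPart b v w N) z) (hv' : RaisesBy 1 (L v)) (hw' : RaisesBy 1 (L w))
    (hz' : RaisesBy 1 (L z)) : expOp hv' * expOp hw' = expOp hz' := by
  have hmap : ∀ N, bchPart (commutator₂ (Module.End ℝ M)) (L v) (L w) N = L (bchPart b v w N) :=
    fun N => (map_bchPart b v w (commutator₂ (Module.End ℝ M)) L
      (fun v w => LinearMap.ext fun x => hL v w x) N).symm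
  refine expOp_mul_expOp hv' hw' hz' (fun N => ?_) (fun V => ?_)
  · rw [hmap]
    exact hr (hb N)
  · simp only [hmap]
    exact hz.map (L.flip V) fun n v hv => by
      simpa using hr hv 0 V (mem_fil_zero V)

/-! ### Quasi-trivial vectors and the Baker-Campbell-Hausdorff series in C-brackets -/

namespace FieldAlgebra

variable {D : ℕ} {A : FieldAlgebra D}

/-- The module generated by the gradients `∂^M η`. -/
def gradSpan (A : FieldAlgebra D) : Submodule A.toSubalgebra (DIdx D → A.toSubalgebra) :=
  Submodule.span A.toSubalgebra (Set.range fun (η : A.toSubalgebra) M => pderivA M.swap η)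

theorem gradient_mem_gradSpan (η : A.toSubalgebra) :
    (fun M : DIdx D => pderivA M.swap η) ∈ gradSpan A := Submodule.subset_span ⟨η, rfl⟩

theorem pderivA_mem_gradSpan (P : DIdx D) {v : DIdx D → A.toSubalgebra} (hv : v ∈ gradSpan A) :
    (fun M => pderivA P (v M)) ∈ gradSpan A := by
  induction hv using Submodule.span_induction with
  | mem v hv =>
    obtain ⟨η, rfl⟩ := hv
    simp only [fun M : DIdx D => pderivA_comm P M.swap η]
    exact gradient_mem_gradSpan _
  | zero =>
    simp only [Pi.zero_apply, map_zero]
    exact Submodule.zero_mem (gradSpan A)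
  | add v w _ _ hv hw =>
    simp only [Pi.add_apply, map_add]
    exact Submodule.add_mem (gradSpan A) hv hw
  | smul f v hv' hv =>
    simp only [Pi.smul_apply, smul_eq_mul, pderivA_mul]
    exact Submodule.add_mem _ (Submodule.smul_mem _ (pderivA P f) hv') (Submodule.smul_mem _ f hv)

theorem gradSpan_transport {v : DIdx D → A.toSubalgebra} (hv : v ∈ gradSpan A)
    (f : A.toSubalgebra) : ∑ P, v P * pderivA P f = 0 := by
  induction hv using Submodule.span_induction with
  | mem v hv =>
    obtain ⟨η, rfl⟩ := hv
    exact pderivA_strong η f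
  | zero => simp
  | add v w _ _ hv hw => simp only [Pi.add_apply, add_mul, Finset.sum_add_distrib, hv, hw, add_zero]
  | smul g v _ hv =>
    simp only [Pi.smul_apply, smul_eq_mul, mul_assoc, ← Finset.mul_sum, hv, mul_zero]

/-- The subspace of quasi-trivial vectors. -/
def quasiTrivial (A : FieldAlgebra D) : Submodule ℝ A.Vec where
  carrier := {ξ | ∀ n, (fun M => (PowerSeries.coeff n (ξ M) : A.toSubalgebra)) ∈ gradSpan A}
  add_mem' hξ hη n := by
    simp only [Pi.add_apply, map_add]
    exact Submodule.add_mem (gradSpan A) (hξ n) (hη n)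
  zero_mem' n := by
    simp only [Pi.zero_apply, map_zero]
    exact Submodule.zero_mem (gradSpan A)
  smul_mem' c ξ hξ n := by
    have := Submodule.smul_mem _ (algebraMap ℝ A.toSubalgebra c) (hξ n)
    convert this using 1
    funext M
    rw [Pi.smul_apply, PowerSeries.coeff_smul, Algebra.smul_def]
    rfl

theorem isQuasiTrivial_iff {ξ : A.Vec} : IsQuasiTrivial ξ ↔ ξ ∈ quasiTrivial A := by
  refine forall_congr' fun n => ?_
  rw [gradSpan, Submodule.mem_span_set']
  refine exists_congr fun k => exists_congr fun ρ => ?_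
  constructor
  · rintro ⟨η, h⟩
    refine ⟨fun i => ⟨_, η i, rfl⟩, funext fun M => Subtype.ext ?_⟩
    rw [h M]
    simp [coe_pderivA]
  · rintro ⟨g, h⟩
    choose η hη using fun i => (g i).2
    refine ⟨η, fun M => ?_⟩
    rw [← congrFun h M]
    simp [← hη, coe_pderivA]

theorem mul_mem_quasiTrivial (f : A.Scalar) {ξ : A.Vec} (hξ : ξ ∈ quasiTrivial A) :
    (fun M => f * ξ M) ∈ quasiTrivial A := fun n => by
  have := Submodule.sum_mem (gradSpan A) (t := antidiagonal n)
    fun p _ => Submodule.smul_mem _ (PowerSeries.coeff p.1 f) (hξ p.2)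
  convert this using 1
  funext M
  simp [PowerSeries.coeff_mul, Finset.sum_apply]

theorem gradient_mem_quasiTrivial (f : A.Scalar) :
    (fun M : DIdx D => d M.swap f) ∈ quasiTrivial A := fun n => by
  simpa only [coeff_d] using gradient_mem_gradSpan _

theorem sum_mem_quasiTrivial {ι : Type*} (s : Finset ι) {ξ : ι → A.Vec}
    (hξ : ∀ i, ξ i ∈ quasiTrivial A) : (fun M => ∑ i ∈ s, ξ i M) ∈ quasiTrivial A := by
  convert Submodule.sum_mem (quasiTrivial A) (t := s) fun i _ => hξ i using 1
  funext M
  rw [Finset.sum_apply]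

theorem transport_quasiTrivial {ξ : A.Vec} (hξ : ξ ∈ quasiTrivial A) (f : A.Scalar) :
    transport ξ f = 0 := PowerSeries.ext fun n => by
  simp only [transport, map_sum, PowerSeries.coeff_mul, coeff_d, map_zero]
  rw [Finset.sum_comm]
  exact Finset.sum_eq_zero fun p _ => gradSpan_transport (hξ p.1) _

theorem cBracketL_antisymm (ξ η : A.Vec) : cBracketL ξ η = -cBracketL η ξ :=
  bracket_antisymm cBracketL cBracketL_self ξ η

/-- The quasi-trivial vectors are an ideal for the C-bracket. -/
theorem cBracket_mem_quasiTrivial (ξ : A.Vec) {η : A.Vec} (hη : η ∈ quasiTrivial A) :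
    cBracketL ξ η ∈ quasiTrivial A := by
  have h1 : (fun M => transport ξ (η M)) ∈ quasiTrivial A :=
    sum_mem_quasiTrivial _ fun P => mul_mem_quasiTrivial (ξ P) fun n => by
      simpa only [coeff_d] using pderivA_mem_gradSpan P (hη n)
  have h2 : (fun M => ∑ P, (ξ P * d M.swap (η P.swap) - η P * d M.swap (ξ P.swap)))
      ∈ quasiTrivial A :=
    sum_mem_quasiTrivial _ fun P => Submodule.sub_mem _
      (mul_mem_quasiTrivial _ (gradient_mem_quasiTrivial _))
      (mul_mem_quasiTrivial _ (gradient_mem_quasiTrivial _))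
  convert Submodule.sub_mem _ h1 (Submodule.smul_mem _ (1 / 2 : ℝ) h2) using 1
  funext M
  simp only [cBracketL_apply, cBracket, Pi.sub_apply, Pi.smul_apply, transport_quasiTrivial hη,
    sub_zero]

/-- Quasi-triviality is tested one coefficient at a time, so it passes to limits in the filtration.
-/
theorem quasiTrivial_closed {v : A.Vec} (h : ∀ n, ∃ u ∈ quasiTrivial A, v - u ∈ fil n) :
    v ∈ quasiTrivial A := fun n => by
  obtain ⟨u, hu, h⟩ := h (n + 1)
  convert hu n using 1
  funext M
  have := mem_fil_pi.1 h M n (by omega)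
  rwa [Pi.sub_apply, map_sub, sub_eq_zero] at this

theorem isTrivial_mem_quasiTrivial {ξ : A.Vec} (h : IsTrivial ξ) : ξ ∈ quasiTrivial A := by
  obtain ⟨f, hf⟩ := h
  rw [show ξ = fun M => d M.swap f from funext hf]
  exact gradient_mem_quasiTrivial f

theorem genLieL_isTrivial {ξ : A.Vec} (h : IsTrivial ξ) : genLieL ξ = 0 := by
  obtain ⟨f, hf⟩ := h
  rw [show ξ = fun M => d M.swap f from funext hf]
  exact LinearMap.ext fun V => genLie_gradient f V

theorem nested_eq : ∀ l : List A.Vec, nested l = nestedBracket cBracketL l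
  | [] => rfl
  | [_] => rfl
  | w :: w' :: l => by
    rw [nested, nested_eq (w' :: l)]
    rfl

theorem nestedBracket_map_mem_fil {α : Type*} {g : α → A.Vec} (hg : ∀ a, g a ∈ fil 1) :
    ∀ l : List α, nestedBracket cBracketL (l.map g) ∈ fil l.length
  | [] => Submodule.zero_mem _
  | [a] => hg a
  | a :: a' :: l => by
    have := cBracket_mem_fil (hg a) (nestedBracket_map_mem_fil hg (a' :: l))
    rwa [add_comm] at this

/-- The letters are exchanged one at a time; beside an exchanged letter, of order n, each of the
other letters contributes at least one order. -/
theorem nestedBracket_map_sub_mem_fil {α : Type*} {g g' : α → A.Vec} (hg : ∀ a, g a ∈ fil 1)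
    (hg' : ∀ a, g' a ∈ fil 1) {n : ℕ} (h : ∀ a, g a - g' a ∈ fil n) : ∀ (a : α) (l : List α),
    nestedBracket cBracketL ((a :: l).map g) - nestedBracket cBracketL ((a :: l).map g')
      ∈ fil (n + l.length)
  | a, [] => h a
  | a, a' :: l => by
    have h1 := cBracket_mem_fil (h a) (nestedBracket_map_mem_fil hg (a' :: l))
    have h2 := cBracket_mem_fil (hg' a) (nestedBracket_map_sub_mem_fil hg hg' h a' l)
    rw [show 1 + (n + l.length) = n + (a' :: l).length by rw [List.length_cons]; omega] at h2
    have := Submodule.add_mem _ h1 h2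
    rw [← cBracketL_apply, ← cBracketL_apply] at this
    convert this using 1
    simp only [List.map_cons, nestedBracket_cons _ _ (List.cons_ne_nil _ _), map_sub,
      LinearMap.sub_apply]
    abel

/-- The innermost bracket is either [ξ, ξ] = 0 or contains a quasi-trivial letter, and the ideal
property carries this outwards. At least two letters are needed, since ξ alone need not be
quasi-trivial. -/
theorem nestedBracket_mem_quasiTrivial {ξ : A.Vec} : ∀ (w w' : A.Vec) (l : List A.Vec),
    (∀ v ∈ w :: w' :: l, v = ξ ∨ v ∈ quasiTrivial A) →
      nestedBracket cBracketL (w :: w' :: l) ∈ quasiTrivial A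
  | w, w', [], h => by
    change cBracketL w w' ∈ _
    rcases h w (by simp) with h1 | h1
    · rcases h w' (by simp) with h2 | h2
      · rw [h1, h2, cBracketL_self]
        exact Submodule.zero_mem _
      · exact cBracket_mem_quasiTrivial _ h2
    · rw [cBracketL_antisymm]
      exact Submodule.neg_mem _ (cBracket_mem_quasiTrivial _ h1)
  | w, w', w'' :: l, h =>
    cBracket_mem_quasiTrivial _ (nestedBracket_mem_quasiTrivial w' w'' l
      fun v hv => h v (List.mem_cons_of_mem _ hv))

/-- The word in two letters with the given exponents. -/
def dynkinWord {k B : ℕ} (p : Fin k → Fin B × Fin B) : List Bool :=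
  (List.ofFn fun i => List.replicate ((p i).1 : ℕ) true ++ List.replicate ((p i).2 : ℕ) false).flatten

theorem length_dynkinWord {k B : ℕ} (p : Fin k → Fin B × Fin B) :
    (dynkinWord p).length = ∑ i, (((p i).1 : ℕ) + (p i).2) := by
  rw [dynkinWord, List.length_flatten, List.map_ofFn, List.sum_ofFn]
  simp

theorem map_dynkinWord {k B : ℕ} (p : Fin k → Fin B × Fin B) (ξ χ : A.Vec) :
    (dynkinWord p).map (fun a => if a then ξ else χ) = (List.ofFn fun i =>
      List.replicate ((p i).1 : ℕ) ξ ++ List.replicate ((p i).2 : ℕ) χ).flatten := by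
  rw [dynkinWord, List.map_flatten, List.map_ofFn]
  congr 2
  funext i
  simp

theorem bchTerm_mem (S : Submodule ℝ A.Vec) {N : ℕ} {ξ χ : A.Vec}
    (h : ∀ l : List Bool, l.length = N →
      nestedBracket cBracketL (l.map fun a => if a then ξ else χ) ∈ S) : bchTerm N ξ χ ∈ S := by
  refine Submodule.sum_mem _ fun k _ => Submodule.sum_mem _ fun p hp => Submodule.smul_mem _ _ ?_
  rw [nested_eq, ← map_dynkinWord]
  exact h _ ((length_dynkinWord p).trans (Finset.mem_filter.1 hp).2.2)

theorem smul_sub_smul_mem (S : Submodule ℝ A.Vec) (c : ℝ) {v w : A.Vec} (h : v - w ∈ S) :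
    c • v - c • w ∈ S := by
  have := S.smul_mem c h
  rwa [smul_sub c v w] at this

theorem bchTerm_sub_mem (S : Submodule ℝ A.Vec) {N : ℕ} {ξ χ χ' : A.Vec}
    (h : ∀ l : List Bool, l.length = N →
      nestedBracket cBracketL (l.map fun a => if a then ξ else χ) -
        nestedBracket cBracketL (l.map fun a => if a then ξ else χ') ∈ S) :
    bchTerm N ξ χ - bchTerm N ξ χ' ∈ S := by
  rw [bchTerm, bchTerm, ← Finset.sum_sub_distrib]
  refine Submodule.sum_mem _ fun k _ => ?_
  rw [← Finset.sum_sub_distrib]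
  refine Submodule.sum_mem _ fun p hp => ?_
  refine smul_sub_smul_mem S _ ?_
  rw [nested_eq, nested_eq, ← map_dynkinWord, ← map_dynkinWord]
  exact h _ ((length_dynkinWord p).trans (Finset.mem_filter.1 hp).2.2)

theorem bchTerm_mem_fil {ξ χ : A.Vec} (hξ : ξ ∈ fil 1) (hχ : χ ∈ fil 1) (N : ℕ) :
    bchTerm N ξ χ ∈ fil N := bchTerm_mem _ fun l hl => by
  rw [← hl]
  exact nestedBracket_map_mem_fil (fun a => by cases a <;> assumption) l

theorem bchTerm_sub_mem_fil {ξ χ χ' : A.Vec} (hξ : ξ ∈ fil 1) (hχ : χ ∈ fil 1) (hχ' : χ' ∈ fil 1)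
    {n : ℕ} (h : χ - χ' ∈ fil n) {N : ℕ} (hN : 2 ≤ N) :
    bchTerm N ξ χ - bchTerm N ξ χ' ∈ fil (n + 1) := bchTerm_sub_mem _ fun l hl => by
  cases l with
  | nil => simp at hl; omega
  | cons a l =>
    refine fil_mono ?_ (nestedBracket_map_sub_mem_fil (n := n) (fun a => ?_) (fun a => ?_)
      (fun a => ?_) a l)
    · rw [List.length_cons] at hl
      omega
    · cases a <;> assumption
    · cases a <;> assumption
    · cases a
      · exact h
      · simp

theorem bchTerm_mem_quasiTrivial (ξ : A.Vec) {χ : A.Vec} (hχ : χ ∈ quasiTrivial A) {N : ℕ}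
    (hN : 2 ≤ N) : bchTerm N ξ χ ∈ quasiTrivial A := bchTerm_mem _ fun l hl => by
  match l, hl with
  | [], hl => simp at hl; omega
  | [_], hl => simp at hl; omega
  | a :: a' :: l, hl =>
    refine nestedBracket_mem_quasiTrivial (ξ := ξ) _ _ _ fun v hv => ?_
    have hv' : v ∈ (a :: a' :: l).map fun a => if a then ξ else χ := hv
    obtain ⟨b, -, rfl⟩ := List.mem_map.1 hv'
    cases b
    · exact Or.inr hχ
    · exact Or.inl rfl

theorem bchTerm_eq (N : ℕ) (ξ χ : A.Vec) : bchTerm N ξ χ = bchPart cBracketL ξ χ N := by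
  have h : ∀ k, (∑ p : Fin (k + 1) → Fin (N + 1) × Fin (N + 1) with
        (∀ i, 0 < ((p i).1 : ℕ) + (p i).2) ∧ ∑ i, (((p i).1 : ℕ) + (p i).2) = N,
      ((-1 : ℝ) ^ (k + 1 - 1) / ((k + 1 : ℕ) * N *
          ∏ i, ((((p i).1 : ℕ) ! : ℝ) * (((p i).2 : ℕ) ! : ℝ)))) •
        nested (List.ofFn fun i =>
          List.replicate ((p i).1 : ℕ) ξ ++ List.replicate ((p i).2 : ℕ) χ).flatten)
      = ((-1 : ℝ) ^ k / ((k + 1) * N)) • wordSum cBracketL ξ χ k N := by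
    intro k
    rw [← sum_words cBracketL ξ χ k le_rfl, Finset.smul_sum]
    refine Finset.sum_congr rfl fun p _ => ?_
    rw [nested_eq, smul_smul, ← div_eq_mul_inv, div_div, Nat.add_sub_cancel]
    push_cast
    rfl
  rw [bchTerm, bchPart, Finset.range_eq_Ico, ← Finset.Ico_add_one_right_eq_Icc,
    ← zero_add 1, ← Finset.sum_Ico_add']
  simp only [zero_add]
  exact Finset.sum_congr rfl fun k _ => h k

theorem sumsTo_single {M : Type*} [AddCommGroup M] [Module ℝ M] [FilteredModule M] {j : ℕ} {u : M}
    (hu : u ∈ fil j) : SumsTo (fun N => if N = j then u else 0) u := fun m => by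
  rw [Finset.sum_ite_eq']
  split_ifs with h
  · simp
  · rw [sub_zero]
    exact fil_mono (by simpa using h) hu

theorem bchHigher_sumsTo {ξ χ : A.Vec} (hξ : ξ ∈ fil 1) (hχ : χ ∈ fil 1) :
    SumsTo (fun N => if N < 4 then 0 else bchTerm N ξ χ) (bchHigher ξ χ) := by
  refine sumsTo_pi fun M => ?_
  have h := sumsTo_mk (u := fun N => (if N < 4 then 0 else bchTerm N ξ χ : A.Vec) M) fun k => by
    split_ifs
    · exact Submodule.zero_mem _
    · exact mem_fil_pi.1 (bchTerm_mem_fil hξ hχ k) M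
  convert h using 1
  refine PowerSeries.ext fun n => ?_
  rw [bchHigher, PowerSeries.coeff_mk, PowerSeries.coeff_mk, map_sum]
  have : Finset.Icc 4 n = (Finset.range (n + 1)).filter fun N => ¬ N < 4 := by
    ext N
    simp only [Finset.mem_Icc, Finset.mem_filter, Finset.mem_range]
    omega
  rw [this, Finset.sum_filter]
  refine Finset.sum_congr rfl fun N _ => ?_
  split_ifs <;> simp

/-- The degree-one part of the full series is ξ + χ; the case distinction at N = 1 drops ξ. -/
theorem bchDelta_sumsTo {ξ χ : A.Vec} (hξ : ξ ∈ fil 1) (hχ : χ ∈ fil 1) :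
    SumsTo (fun N => if N = 1 then χ else bchTerm N ξ χ) (bchDelta ξ χ) := by
  have hterm := bchTerm_mem_fil hξ hχ
  have h0 : bchTerm 0 ξ χ = 0 := rfl
  have h2 : (1 / 2 : ℝ) • cBracket ξ χ = bchTerm 2 ξ χ := by
    rw [bchTerm_eq, bchPart_two cBracketL ξ χ cBracketL_self, cBracketL_apply]
  have h3 : (1 / 12 : ℝ) • (cBracket ξ (cBracket ξ χ) + cBracket χ (cBracket χ ξ))
      = bchTerm 3 ξ χ := by
    rw [bchTerm_eq, bchPart_three cBracketL ξ χ cBracketL_self]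
    simp only [cBracketL_apply]
  rw [bchDelta, h2, h3]
  convert (((sumsTo_single hχ).add (sumsTo_single (hterm 2))).add (sumsTo_single (hterm 3))).add
    (bchHigher_sumsTo hξ hχ) using 1
  funext N
  rcases N with _ | _ | _ | _ | N
  · simp [h0]
  · simp
  · simp
  · simp
  · simp

theorem add_bchDelta_sumsTo {ξ χ : A.Vec} (hξ : ξ ∈ fil 1) (hχ : χ ∈ fil 1) :
    SumsTo (fun N => bchPart cBracketL ξ χ N) (ξ + bchDelta ξ χ) := by
  convert (sumsTo_single hξ).add (bchDelta_sumsTo hξ hχ) using 1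
  funext N
  split_ifs with h
  · rw [h, bchPart_one cBracketL ξ χ cBracketL_self]
  · rw [zero_add, bchTerm_eq]

theorem bchDelta_mem_fil {ξ χ : A.Vec} (hξ : ξ ∈ fil 1) (hχ : χ ∈ fil 1) :
    bchDelta ξ χ ∈ fil 1 := (bchDelta_sumsTo hξ hχ).mem_of_vanish fun k hk => by
  obtain rfl : k = 0 := by omega
  simp [bchTerm]

theorem bchDelta_mem_quasiTrivial {ξ χ : A.Vec} (hξ : ξ ∈ fil 1) (hχ : χ ∈ fil 1)
    (h : χ ∈ quasiTrivial A) : bchDelta ξ χ ∈ quasiTrivial A :=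
  quasiTrivial_closed fun n => ⟨_, Submodule.sum_mem _ fun k _ => by
    split_ifs with h1
    · exact h
    · rcases k with _ | _ | k
      · simp [bchTerm]
      · exact absurd rfl h1
      · exact bchTerm_mem_quasiTrivial ξ h (by omega), bchDelta_sumsTo hξ hχ n⟩

/-- The contraction estimate for solving `bchDelta ξ χ = δ`: what remains after removing χ has
degree at least two, so a change of χ is always accompanied by another letter of positive order. -/
theorem bchDelta_sub_mem_fil {ξ χ χ' : A.Vec} (hξ : ξ ∈ fil 1) (hχ : χ ∈ fil 1)
    (hχ' : χ' ∈ fil 1) {n : ℕ} (h : χ - χ' ∈ fil n) :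
    bchDelta ξ χ - χ - (bchDelta ξ χ' - χ') ∈ fil (n + 1) := by
  have hs := Submodule.sub_mem _ (bchDelta_sumsTo hξ hχ (n + 2)) (bchDelta_sumsTo hξ hχ' (n + 2))
  have hsum : ∑ k ∈ Finset.range (n + 2), (if k = 1 then 0 else bchTerm k ξ χ - bchTerm k ξ χ')
      ∈ fil (n + 1) := Submodule.sum_mem _ fun k _ => by
    split_ifs with h1
    · exact Submodule.zero_mem _
    · rcases k with _ | _ | k
      · simp [bchTerm]
      · exact absurd rfl h1
      · exact bchTerm_sub_mem_fil hξ hχ hχ' h (by omega)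
  have e : ∑ k ∈ Finset.range (n + 2), (if k = 1 then χ else bchTerm k ξ χ)
      - ∑ k ∈ Finset.range (n + 2), (if k = 1 then χ' else bchTerm k ξ χ')
      = (χ - χ') + ∑ k ∈ Finset.range (n + 2),
        (if k = 1 then 0 else bchTerm k ξ χ - bchTerm k ξ χ') := by
    have h1 : χ - χ' = ∑ k ∈ Finset.range (n + 2), if k = 1 then χ - χ' else 0 := by
      rw [Finset.sum_ite_eq', if_pos (by simp)]
    rw [h1, ← Finset.sum_sub_distrib, ← Finset.sum_add_distrib]
    refine Finset.sum_congr rfl fun k _ => ?_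
    split_ifs <;> simp
  convert Submodule.add_mem _ (fil_succ_le _ hs) hsum using 1
  dsimp only
  rw [sub_sub_sub_comm (bchDelta ξ χ) (∑ k ∈ _, _), e]
  abel

/-- Every quasi-trivial parameter is of the form `bchDelta ξ χ`. -/
theorem exists_bchDelta_eq {ξ δ : A.Vec} (hξ : ξ ∈ fil 1) (hδ : δ ∈ fil 1)
    (hδ' : δ ∈ quasiTrivial A) : ∃ χ ∈ fil 1, χ ∈ quasiTrivial A ∧ bchDelta ξ χ = δ := by
  obtain ⟨χ, ⟨h1, h2⟩, h⟩ := exists_fixedPoint (M := A.Vec)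
    {χ | χ ∈ fil 1 ∧ χ ∈ quasiTrivial A} (v₀ := 0) ⟨Submodule.zero_mem _, Submodule.zero_mem _⟩
    (fun v hv => ⟨by
        obtain ⟨u, hu, h⟩ := hv 1
        simpa using Submodule.add_mem _ h hu.1,
      quasiTrivial_closed fun n => by
        obtain ⟨u, hu, h⟩ := hv n
        exact ⟨u, hu.2, h⟩⟩)
    (fun χ => δ - (bchDelta ξ χ - χ))
    (fun χ hχ => ⟨Submodule.sub_mem _ hδ (Submodule.sub_mem _ (bchDelta_mem_fil hξ hχ.1) hχ.1),
      Submodule.sub_mem _ hδ'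
        (Submodule.sub_mem _ (bchDelta_mem_quasiTrivial hξ hχ.1 hχ.2) hχ.2)⟩)
    (fun n χ hχ χ' hχ' h => by
      convert Submodule.neg_mem _ (bchDelta_sub_mem_fil hξ hχ.1 hχ'.1 h) using 1
      abel)
  refine ⟨χ, h1, h2, ?_⟩
  rw [sub_sub_eq_add_sub, sub_eq_iff_eq_add, add_comm χ, add_left_inj] at h
  exact h.symm

/-- The Baker-Campbell-Hausdorff formula for generalized Lie derivatives. -/
theorem expOp_genLieL_add_bchDelta {ξ χ : A.Vec} (hξ : ξ ∈ fil 1) (hχ : χ ∈ fil 1)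
    (h : ξ + bchDelta ξ χ ∈ fil 1) :
    expOp (genLieL_raisesBy hξ) * expOp (genLieL_raisesBy hχ) = expOp (genLieL_raisesBy h) := by
  have hL : ∀ v w x : A.Vec, genLieL (cBracketL v w) x
      = genLieL v (genLieL w x) - genLieL w (genLieL v x) := genLie_cBracket
  have hb : ∀ N, bchPart cBracketL ξ χ N ∈ fil N := fun N => by
    rw [← bchTerm_eq]
    exact bchTerm_mem_fil hξ hχ N
  have key := expOp_mul_expOp_of_bracket (V := A.Vec) (M := A.Vec) cBracketL genLieL hL
    (fun h => genLieL_raisesBy h) hb (add_bchDelta_sumsTo hξ hχ)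
  exact key _ _ _

theorem transportL_quasiTrivial {ξ : A.Vec} (hξ : ξ ∈ quasiTrivial A) : transportL ξ = 0 :=
  LinearMap.ext fun f => transport_quasiTrivial hξ f

theorem largeG_quasiTrivial {χ : A.Vec} (hχ : χ ∈ fil 1) (hχ' : χ ∈ quasiTrivial A) (V : A.Vec) :
    largeG χ V = expOp (genLieL_raisesBy hχ) V := funext fun M => by
  rw [largeG_apply hχ, expOp_of_eq_zero _ (transportL_quasiTrivial (Submodule.neg_mem _ hχ'))]
  rfl

theorem largeG_congr {ξ ξ' : A.Vec} (hξ : ξ ∈ fil 1) (hξ' : ξ' ∈ fil 1)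
    (hT : transportL ξ = transportL ξ') (hL : genLieL ξ = genLieL ξ') : largeG ξ = largeG ξ' :=
  funext fun V => funext fun M => by
    have hT' : transportL (-ξ) = transportL (-ξ') := by rw [map_neg, hT, map_neg]
    rw [largeG_apply hξ, largeG_apply hξ', expOp_congr _ (genLieL_raisesBy hξ') hL,
      expOp_congr _ (transportL_raisesBy (Submodule.neg_mem _ hξ')) hT']

/-- A quasi-trivial shift leaves the transport operator unchanged, so only the exponentials of the
generalized Lie derivatives have to be multiplied. -/
theorem largeG_add_bchDelta {ξ χ : A.Vec} (hξ : ξ ∈ fil 1) (hχ : χ ∈ fil 1)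
    (hχ' : χ ∈ quasiTrivial A) : largeG (ξ + bchDelta ξ χ) = largeG ξ ∘ largeG χ := by
  have h := Submodule.add_mem _ hξ (bchDelta_mem_fil hξ hχ)
  have hT : transportL (-(ξ + bchDelta ξ χ)) = transportL (-ξ) := by
    rw [map_neg, map_neg, map_add,
      transportL_quasiTrivial (bchDelta_mem_quasiTrivial hξ hχ hχ'), add_zero]
  refine funext fun V => funext fun M => ?_
  rw [Function.comp_apply, largeG_apply h, largeG_apply hξ, largeG_quasiTrivial hχ hχ',
    ← expOp_genLieL_add_bchDelta hξ hχ h,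
    expOp_congr _ (transportL_raisesBy (Submodule.neg_mem _ hξ)) hT]
  rfl

theorem largeG_add_of_isTrivial {ξ χ δ : A.Vec} (hξ : ξ ∈ fil 1) (hχ : χ ∈ fil 1)
    (hχ' : χ ∈ quasiTrivial A) (hδ : δ ∈ fil 1) (h : IsTrivial (δ - bchDelta ξ χ)) :
    δ ∈ quasiTrivial A ∧ largeG (ξ + δ) = largeG ξ ∘ largeG χ := by
  have hb := bchDelta_mem_quasiTrivial hξ hχ hχ'
  have e : ξ + δ = (ξ + bchDelta ξ χ) + (δ - bchDelta ξ χ) := by abel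
  have hq := isTrivial_mem_quasiTrivial h
  refine ⟨by simpa using Submodule.add_mem _ hq hb, ?_⟩
  rw [← largeG_add_bchDelta hξ hχ hχ']
  refine largeG_congr (Submodule.add_mem _ hξ hδ)
    (Submodule.add_mem _ hξ (bchDelta_mem_fil hξ hχ)) ?_ ?_
  · rw [e, map_add, transportL_quasiTrivial hq, add_zero]
  · rw [e, map_add, genLieL_isTrivial h, add_zero]

end FieldAlgebra

/-! ### Comparing exponentials at leading order -/

section Operators

variable {M M' : Type*} [AddCommGroup M] [Module ℝ M] [FilteredModule M]
  [AddCommGroup M'] [Module ℝ M'] [FilteredModule M']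

theorem expOp_sub_one {T : Module.End ℝ M} (hT : RaisesBy 1 T) : RaisesBy 1 (expOp hT - 1) := by
  have h0 : RaisesBy 1 (0 : Module.End ℝ M) := fun n v _ => Submodule.zero_mem _
  have h := expOp_sub_expOp h0 hT (n := 0) fun n v hv => by
    simpa using fil_mono (by omega) (hT n v hv)
  rw [expOp_of_eq_zero h0 rfl, sub_zero] at h
  simpa using h.add hT

theorem expOp_intertwine {S : Module.End ℝ M} {T : Module.End ℝ M'} (hS : RaisesBy 1 S)
    (hT : RaisesBy 1 T) (L : M →ₗ[ℝ] M') (hL : RaisesBy 0 L) (h : ∀ v, T (L v) = L (S v)) (v : M) :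
    expOp hT (L v) = L (expOp hS v) := by
  have hpow : ∀ k, (T ^ k) (L v) = L ((S ^ k) v) := fun k => by
    induction k with
    | zero => rfl
    | succ k ih => rw [pow_succ', pow_succ', Module.End.mul_apply, Module.End.mul_apply, ih, h]
  refine (expOp_sumsTo hT (L v)).unique ?_
  simpa only [hpow, map_smul] using (expOp_sumsTo hS v).map L hL

/-- If conjugating `δ` by the exponentials of `S` and of `T` gives the same result on `f`, then
the leading part of the commutator of `δ` with `S - T` vanishes on `f`. -/
theorem leading_commutator_mem_fil {S T δ : Module.End ℝ M} (hS : RaisesBy 1 S) (hT : RaisesBy 1 T)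
    (hδ : RaisesBy 0 δ) {n : ℕ} (h : RaisesBy n (S - T)) {f : M}
    (hf : expOp hS.neg (δ (expOp hS f)) = expOp hT.neg (δ (expOp hT f))) (h0 : (S - T) (δ f) = 0) :
    δ ((S - T) f) ∈ fil (n + 1) := by
  -- Up to order n + 1, `h1` (carried along in `h2`) and `h4` replace the differences of
  -- exponentials by differences of exponents, and `h3` and `h5` replace the remaining exponentials
  -- by 1.
  have hf0 := mem_fil_zero f
  have h1 := hδ _ _ (expOp_sub_expOp hT hS h 0 f hf0)
  have h2 := expOp_raisesBy hS.neg _ _ h1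
  have h3 := expOp_sub_one hS.neg _ _ (hδ _ _ (h 0 f hf0))
  have hneg : RaisesBy n (-S - -T) := by
    convert h.neg using 1
    abel
  have h4 := expOp_sub_expOp hT.neg hS.neg hneg 0 (δ (expOp hT f)) (mem_fil_zero _)
  have h5 := h _ _ (hδ _ _ (expOp_sub_one hT 0 f hf0))
  simp only [zero_add, add_zero, add_comm 1 n, LinearMap.sub_apply, map_sub, Module.End.one_apply,
    LinearMap.neg_apply] at *
  have e := Submodule.sub_mem _ (Submodule.sub_mem _ h5 h2) (Submodule.add_mem _ h3 h4)
  convert e using 1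
  rw [← sub_eq_zero] at hf h0
  have z := congrArg₂ (· + ·) hf h0
  rw [add_zero] at z
  refine sub_eq_zero.1 (Eq.trans ?_ z)
  abel

end Operators


/-! ### Rigidity: how far G(ξ) determines ξ -/

namespace FieldAlgebra

variable {D : ℕ} {A : FieldAlgebra D}

theorem transportL_neg (ξ : A.Vec) : transportL (-ξ) = -transportL ξ :=
  LinearMap.ext fun f => by
    simp [transportL_apply, transport]

theorem transportL_sub (ξ η : A.Vec) : transportL (ξ - η) = transportL ξ - transportL η :=
  LinearMap.ext fun f => by
    simp [transportL_apply, transport]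

/-- The gradient `∂_M f`, as a linear map. -/
def gradL : A.Scalar →ₗ[ℝ] A.Vec := LinearMap.pi dL

theorem gradL_apply (f : A.Scalar) (M : DIdx D) : gradL f M = d M f := rfl

theorem gradL_raisesBy : RaisesBy 0 (gradL (A := A)) := fun _ _ hf =>
  mem_fil_pi.2 fun M => d_mem_fil M hf

theorem dL_raisesBy (M : DIdx D) : RaisesBy 0 (dL (A := A) M) := fun _ _ hf => d_mem_fil M hf

/-- On gradients the term with ∂^K ξ_M drops out by the strong constraint, and the rest is the usual
Lie derivative of an exact one-form. -/
theorem genLie_grad (ξ : A.Vec) (f : A.Scalar) : genLie ξ (gradL f) = gradL (transport ξ f) :=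
  funext fun M => by
    have h : ∑ K : DIdx D, d K.swap (ξ M.swap) * d K f = 0 := d_strong _ _
    rw [genLie_apply, gradL_apply, gradL_apply, d_transport, add_comm]
    simp only [curl, gradL_apply, sub_mul, Finset.sum_sub_distrib, h, sub_zero]

/-- This extracts from G(ξ) a statement about the transport operator alone. -/
theorem largeG_grad {ξ : A.Vec} (hξ : ξ ∈ fil 1) (f : A.Scalar) (M : DIdx D) :
    largeG ξ (gradL f) M
      = expOp (transportL_raisesBy hξ).neg (dL M (expOp (transportL_raisesBy hξ) f)) := by
  rw [largeG_apply hξ, expOp_intertwine (transportL_raisesBy hξ) (genLieL_raisesBy hξ) gradL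
    gradL_raisesBy (genLie_grad ξ) f, expOp_congr _ (transportL_raisesBy hξ).neg (transportL_neg _)]
  rfl

theorem expScalar_transport_neg {ξ : A.Vec} (hξ : ξ ∈ fil 1) (f : A.Scalar) :
    expScalar (transport (-ξ)) f = expOp (transportL_raisesBy hξ).neg f := by
  rw [expOp_congr _ (transportL_raisesBy (Submodule.neg_mem _ hξ)) (transportL_neg _).symm]
  exact expScalar_eq (transportL_raisesBy (Submodule.neg_mem _ hξ)) f

theorem transport_C (ξ : A.Vec) (f : A.toSubalgebra) (n : ℕ) :
    PowerSeries.coeff n (transport ξ (PowerSeries.C f))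
      = ∑ P, PowerSeries.coeff n (ξ P) * pderivA P f := by
  have hC : ∀ P, d P (PowerSeries.C f : A.Scalar) = PowerSeries.C (pderivA P f) := fun P => by
    ext1 k
    rw [coeff_d, PowerSeries.coeff_C, PowerSeries.coeff_C]
    split_ifs
    · rfl
    · exact map_zero _
  simp only [transport, map_sum, hC, PowerSeries.coeff_mul_C]

/-- If `ξ` and `η` generate the same transformation of vectors, then the leading part of
`(ξ - η)^P ∂_P f` is constant for every function `f` with constant partial derivatives. -/
theorem pderivA_coeff_transport_sub {ξ η : A.Vec} (hξ : ξ ∈ fil 1) (hη : η ∈ fil 1)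
    (hG : largeG ξ = largeG η) {n : ℕ} (hT : RaisesBy n (transportL (ξ - η))) {f : A.toSubalgebra}
    (hf : ∀ M P, pderivA M (pderivA P f) = 0) (M : DIdx D) :
    pderivA M (PowerSeries.coeff n (transport (ξ - η) (PowerSeries.C f))) = 0 := by
  have hT' : RaisesBy n (transportL ξ - transportL η) := by rwa [← transportL_sub]
  have h0 : (transportL ξ - transportL η) (dL M (PowerSeries.C f)) = 0 := by
    rw [← transportL_sub, transportL_apply, transport]
    refine Finset.sum_eq_zero fun P _ => ?_
    have h0 : d P (d M (PowerSeries.C f : A.Scalar)) = 0 := by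
      ext1 k
      rw [coeff_d, coeff_d, PowerSeries.coeff_C]
      split_ifs
      · rw [hf]; rfl
      · rw [map_zero, map_zero]; rfl
    rw [dL_apply, h0, mul_zero]
  have h := leading_commutator_mem_fil (transportL_raisesBy hξ) (transportL_raisesBy hη)
    (dL_raisesBy M) hT' (f := PowerSeries.C f)
    (by rw [← largeG_grad hξ, ← largeG_grad hη, hG]) h0
  rw [← transportL_sub] at h
  rw [← coeff_d]
  exact h n (Nat.lt_succ_self n)

/-- At order n the two exponentials differ by the transport along ξ - η, up to sign. Agreement at X₀
thus fixes the constant that G leaves undetermined. -/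
theorem coeff_transport_sub_apply {ξ η : A.Vec} (hξ : ξ ∈ fil 1) (hη : η ∈ fil 1)
    {X₀ : Doubled D} (h : AgreeAt ξ η X₀) {n : ℕ} (hT : RaisesBy n (transportL (ξ - η)))
    (f : A.toSubalgebra) :
    (PowerSeries.coeff n (transport (ξ - η) (PowerSeries.C f)) : A.toSubalgebra).1 X₀ = 0 := by
  have hS : RaisesBy n (-transportL ξ - -transportL η) := by
    convert hT.neg using 1
    rw [transportL_sub]
    abel
  have h1 := expOp_sub_expOp (transportL_raisesBy hη).neg (transportL_raisesBy hξ).neg hS 0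
    (PowerSeries.C f) (mem_fil_zero _) n (by omega)
  have h2 := h f n
  rw [expScalar_transport_neg hξ, expScalar_transport_neg hη] at h2
  have e : PowerSeries.coeff n (transport (ξ - η) (PowerSeries.C f))
      = PowerSeries.coeff n (expOp (transportL_raisesBy hη).neg (PowerSeries.C f))
        - PowerSeries.coeff n (expOp (transportL_raisesBy hξ).neg (PowerSeries.C f)) := by
    have e1 : transport (ξ - η) (PowerSeries.C f)
        = transportL ξ (PowerSeries.C f) - transportL η (PowerSeries.C f) := by
      rw [← transportL_apply, transportL_sub]; rfl
    rw [e1, map_sub, ← sub_eq_zero, ← h1]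
    simp only [LinearMap.sub_apply, LinearMap.neg_apply, map_sub, map_neg]
    abel
  rw [e]
  exact sub_eq_zero.2 h2.symm

theorem sum_mul_partialD (f : Doubled D → ℝ) (X w : Doubled D) :
    ∑ P, w P * partialD P f X = fderiv ℝ f X w := by
  have h := (fderiv ℝ f X).toLinearMap.pi_apply_eq_sum_univ w
  rw [ContinuousLinearMap.coe_coe] at h
  rw [h]
  refine Finset.sum_congr rfl fun P _ => ?_
  rw [smul_eq_mul, partialD]
  congr 2
  funext i
  simp [Pi.single_apply, eq_comm]

/-- The coefficient of order `n` of a vector, at the point `X`. -/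
def coeffAt (ξ : A.Vec) (n : ℕ) (X : Doubled D) : Doubled D := fun P =>
  (PowerSeries.coeff n (ξ P) : A.toSubalgebra).1 X

theorem sum_coeff_mul_pderivA_apply (ξ : A.Vec) (n : ℕ) (f : A.toSubalgebra) (X : Doubled D) :
    (∑ P, PowerSeries.coeff n (ξ P) * pderivA P f : A.toSubalgebra).1 X
      = fderiv ℝ f.1 X (coeffAt ξ n X) := by
  rw [← sum_mul_partialD, AddSubmonoidClass.coe_finsetSum, Finset.sum_apply]
  rfl

theorem fderiv_eq_zero_of_const {f : Doubled D → ℝ} {X v : Doubled D}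
    (hf : DifferentiableAt ℝ f X) (h : ∀ t : ℝ, f (X + t • v) = f X) : fderiv ℝ f X v = 0 := by
  rw [← hf.lineDeriv_eq_fderiv, lineDeriv]
  simp [h]

/-! ### Sections: tangency to the isotropic subspace and the Poincaré lemma -/

section Isotropic

variable {N : Submodule ℝ (Doubled D)}
  (hA : ∀ f : Doubled D → ℝ, f ∈ A.toSubalgebra ↔
      ContDiff ℝ ∞ f ∧ ∀ X : Doubled D, ∀ v ∈ N, f (X + v) = f X)
include hA

/-- Coefficients tangent to N do not differentiate functions that are constant along N, so the first
effective order is n. -/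
theorem transportL_raisesBy_of_coeffAt_mem {ξ : A.Vec} {n : ℕ}
    (h : ∀ i < n, ∀ X, coeffAt ξ i X ∈ N) : RaisesBy n (transportL ξ) := by
  intro m f hf k hk
  rw [transportL_apply, transport, map_sum]
  simp only [PowerSeries.coeff_mul, coeff_d]
  rw [Finset.sum_comm]
  refine Finset.sum_eq_zero fun p hp => ?_
  rw [mem_antidiagonal] at hp
  by_cases hn : p.1 < n
  · refine Subtype.ext (funext fun X => ?_)
    rw [sum_coeff_mul_pderivA_apply]
    exact fderiv_eq_zero_of_const (differentiableAt_coe _ X) fun t =>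
      ((hA _).1 (PowerSeries.coeff p.2 f).2).2 X _ (N.smul_mem t (h _ hn X))
  · refine Finset.sum_eq_zero fun P _ => ?_
    rw [hf p.2 (by omega), map_zero, mul_zero]

/-- Linear functions that vanish on `N` detect membership of `N`. -/
theorem coeffAt_mem_of_transport_C {ξ : A.Vec} {n : ℕ}
    (h : ∀ f : A.toSubalgebra, (∀ M P, pderivA M (pderivA P f) = 0) →
      PowerSeries.coeff n (transport ξ (PowerSeries.C f)) = 0) (X : Doubled D) :
    coeffAt ξ n X ∈ N := by
  by_contra hX
  obtain ⟨l, hl, hlN⟩ := Submodule.exists_le_ker_of_notMem hX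
  let L : Doubled D →L[ℝ] ℝ := LinearMap.toContinuousLinearMap l
  have hL : (L : Doubled D → ℝ) ∈ A.toSubalgebra := (hA _).2 ⟨L.contDiff, fun Y v hv => by
    have : L v = 0 := hlN hv
    rw [map_add, this, add_zero]⟩
  have h0 := h ⟨L, hL⟩ fun M P => by
    refine Subtype.ext (funext fun Y => ?_)
    have : partialD P (L : Doubled D → ℝ) = fun _ => L (Pi.single P 1) := by
      funext Z
      rw [partialD, L.fderiv]
    change partialD M (partialD P L) Y = 0
    rw [this, partialD]
    simp
  rw [transport_C] at h0
  have h1 := congrFun (congrArg Subtype.val h0) X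
  rw [sum_coeff_mul_pderivA_apply, L.fderiv] at h1
  exact hl h1

/-- If two parameters generate the same transformation of vectors, and their coordinate
transformations agree at a point, then their difference is tangent to `N`. -/
theorem coeffAt_sub_mem {ξ η : A.Vec} (hξ : ξ ∈ fil 1) (hη : η ∈ fil 1)
    (hG : largeG ξ = largeG η) {X₀ : Doubled D} (hX : AgreeAt ξ η X₀) (n : ℕ) (X : Doubled D) :
    coeffAt (ξ - η) n X ∈ N := by
  induction n using Nat.strong_induction_on generalizing X with
  | _ n ih =>
    have hT := transportL_raisesBy_of_coeffAt_mem hA ih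
    refine coeffAt_mem_of_transport_C hA (fun f hf => ?_) X
    set g : A.toSubalgebra := PowerSeries.coeff n (transport (ξ - η) (PowerSeries.C f)) with hg
    have hd : ∀ Y, fderiv ℝ g.1 Y = 0 := fun Y => by
      ext1 w
      rw [← sum_mul_partialD]
      refine Finset.sum_eq_zero fun P _ => ?_
      have h1 := congrFun (congrArg Subtype.val (pderivA_coeff_transport_sub hξ hη hG hT hf P)) Y
      change partialD P g.1 Y = 0 at h1
      rw [h1, mul_zero]
    refine Subtype.ext (funext fun Y => ?_)
    -- The coefficient g has zero gradient, so its value can be computed at the point of agreement.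
    rw [is_const_of_fderiv_eq_zero (𝕜 := ℝ) (fun Z => differentiableAt_coe g Z) hd Y X₀]
    exact coeff_transport_sub_apply hξ hη hX hT f

omit hA in
-- With equal transports the common invertible factor exp(-ξ^P ∂_P) cancels, and exponentials have
-- unique logarithms.
theorem genLieL_eq_of_largeG_eq {ξ η : A.Vec} (hξ : ξ ∈ fil 1) (hη : η ∈ fil 1)
    (hG : largeG ξ = largeG η) (hT : transportL ξ = transportL η) : genLieL ξ = genLieL η := by
  refine expOp_injective (genLieL_raisesBy hη) (genLieL_raisesBy hξ) (LinearMap.ext fun V =>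
    funext fun M => ?_)
  have h := congrFun (congrFun hG V) M
  rw [largeG_apply hξ, largeG_apply hη, expOp_congr _ (transportL_raisesBy hξ).neg
    (transportL_neg ξ), expOp_congr (transportL_raisesBy (Submodule.neg_mem _ hη))
    (transportL_raisesBy hξ).neg (by rw [transportL_neg, hT])] at h
  have h' := congrArg (expOp (transportL_raisesBy hξ)) h
  rwa [← Module.End.mul_apply, ← Module.End.mul_apply, expOp_mul_expOp_neg, Module.End.one_apply,
    Module.End.one_apply] at h'

omit hA in
-- Unit vectors pick out the matrix entries once the equal transport parts have been cancelled.
theorem curl_eq_zero {ξ η : A.Vec} (hT : transportL ξ = transportL η)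
    (hL : genLieL ξ = genLieL η) (M K : DIdx D) : curl (ξ - η) M K = 0 := by
  have hL' : ∀ V, genLie ξ V M = genLie η V M := fun V => congrFun (LinearMap.congr_fun hL V) M
  have h := hL' (Pi.single K 1)
  rw [genLie_apply, genLie_apply, ← transportL_apply, ← transportL_apply, hT, add_right_inj] at h
  simp only [Pi.single_apply, mul_ite, mul_one, mul_zero, Finset.sum_ite_eq', Finset.mem_univ,
    if_true] at h
  have e : curl (ξ - η) M K = curl ξ M K - curl η M K := by
    simp only [curl, Pi.sub_apply, d_sub]
    abel
  rw [e, h, sub_self]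

/-- A vector that is tangent to `N` and closed as a one-form is trivial. -/
theorem isTrivial_of_curl_eq_zero (hN : ∀ v ∈ N, ∀ w ∈ N, ∑ P : DIdx D, v P.swap * w P = 0)
    {β : A.Vec} (hβ : ∀ n X, coeffAt β n X ∈ N) (hc : ∀ M K, curl β M K = 0) : IsTrivial β := by
  have key : ∀ n, ∃ f : A.toSubalgebra, ∀ M, PowerSeries.coeff n (β M) = pderivA M.swap f := by
    intro n
    let c : DIdx D → A.toSubalgebra := fun M => PowerSeries.coeff n (β M.swap)
    let θ : Doubled D → Doubled D →L[ℝ] ℝ := fun X =>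
      ∑ M, (c M).1 X • (ContinuousLinearMap.proj M : Doubled D →L[ℝ] ℝ)
    have hθs : ContDiff ℝ ∞ θ := ContDiff.sum fun M _ => (contDiff_coe (c M)).smul contDiff_const
    have hθ : ∀ X v, θ X v = ∑ M, (c M).1 X * v M := fun X v => by
      simp [θ]
    have hcc : ∀ M K, pderivA M (c K) = pderivA K (c M) := fun M K => by
      have h := congrArg (PowerSeries.coeff n) (hc M K.swap)
      simp only [curl, map_sub, coeff_d, Sum.swap_swap, map_zero] at h
      exact sub_eq_zero.1 h
    have hd : ∀ X, HasFDerivAt θ (∑ M, (fderiv ℝ (c M).1 X).smulRight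
        (ContinuousLinearMap.proj M : Doubled D →L[ℝ] ℝ)) X := fun X =>
      HasFDerivAt.fun_sum fun M _ => (differentiableAt_coe (c M) X).hasFDerivAt.smul_const
        (ContinuousLinearMap.proj M : Doubled D →L[ℝ] ℝ)
    have hsymm : ∀ X v w, fderiv ℝ θ X v w = fderiv ℝ θ X w v := fun X v w => by
      have e : ∀ v w, fderiv ℝ θ X v w = ∑ M, ∑ K, v K * (pderivA K (c M)).1 X * w M :=
        fun v w => by
          rw [(hd X).fderiv]
          simp only [_root_.sum_apply, ContinuousLinearMap.smulRight_apply,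
            _root_.smul_apply, ContinuousLinearMap.proj_apply, smul_eq_mul,
            ← sum_mul_partialD, Finset.sum_mul]
          rfl
      rw [e, e, Finset.sum_comm]
      refine Finset.sum_congr rfl fun M _ => Finset.sum_congr rfl fun K _ => ?_
      rw [hcc]
      ring
    -- The Poincaré lemma on the whole space: θ is the order-n part of β with its index lowered, and
    -- vanishing curl is closedness.
    obtain ⟨f, hf⟩ := convex_univ.exists_forall_hasFDerivAt_of_fderiv_symmetric isOpen_univ
      (hθs.differentiable (by simp)).differentiableOn fun X _ => hsymm X
    replace hf : ∀ X, HasFDerivAt f (θ X) X := fun X => hf X trivial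
    have hfd : fderiv ℝ f = θ := funext fun X => (hf X).fderiv
    have hfs : ContDiff ℝ ∞ f := contDiff_infty_iff_fderiv.2
      ⟨fun X => (hf X).differentiableAt, hfd ▸ hθs⟩
    -- The derivative of f along v ∈ N is the O(D,D) pairing of v with a coefficient of β, which
    -- also lies in N; isotropy makes it zero.
    have hfN : ∀ X, ∀ v ∈ N, f (X + v) = f X := fun X v hv => by
      have h1 : ∀ t : ℝ, HasDerivAt (fun t : ℝ => f (X + t • v)) 0 t := fun t => by
        have h2 : HasDerivAt (fun t : ℝ => X + t • v) v t := by
          simpa using ((hasDerivAt_id t).smul_const v).const_add X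
        have h3 := (hf (X + t • v)).comp_hasDerivAt t h2
        rw [hθ] at h3
        have h4 := hN _ (hβ n (X + t • v)) v hv
        rw [show ∑ M, (c M).1 (X + t • v) * v M = 0 from h4] at h3
        exact h3
      have h2 := is_const_of_deriv_eq_zero (fun t => (h1 t).differentiableAt)
        (fun t => (h1 t).deriv) 1 0
      simpa using h2
    refine ⟨⟨f, (hA f).2 ⟨hfs, hfN⟩⟩, fun M => Subtype.ext (funext fun X => ?_)⟩
    change _ = fderiv ℝ f X (Pi.single M.swap 1)
    rw [hfd, hθ]
    simp [Pi.single_apply, c]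
  choose f hf using key
  exact ⟨PowerSeries.mk f, fun M => PowerSeries.ext fun n => by
    rw [coeff_d, PowerSeries.coeff_mk, hf]⟩

end Isotropic

theorem transportL_eq_of_sub {ξ η : A.Vec} (h : transportL (ξ - η) = 0) :
    transportL ξ = transportL η := LinearMap.ext fun f => sub_eq_zero.1 <| by
  have h' := LinearMap.congr_fun h f
  rwa [transportL_sub] at h'

theorem isTrivial_sub_of_largeG_eq (hA : A.IsSection) {ξ η : A.Vec} (hξ : ξ ∈ fil 1)
    (hη : η ∈ fil 1) (hG : largeG ξ = largeG η) {X₀ : Doubled D} (hX : AgreeAt ξ η X₀) :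
    IsTrivial (ξ - η) := by
  obtain ⟨N, -, hN, hA⟩ := hA
  have hβ := coeffAt_sub_mem hA hξ hη hG hX
  have h0 := transportL_eq_of_sub (RaisesBy.eq_zero fun n =>
    transportL_raisesBy_of_coeffAt_mem hA (n := n) fun i _ => hβ i)
  exact isTrivial_of_curl_eq_zero hA hN hβ
    (curl_eq_zero h0 (genLieL_eq_of_largeG_eq hξ hη hG h0))

theorem agreeAt_of_transportL_eq {ξ η : A.Vec} (h : transportL ξ = transportL η)
    (X₀ : Doubled D) : AgreeAt ξ η X₀ := fun f n => by
  have e : transport (-ξ) = transport (-η) := by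
    have h' : transportL (-ξ) = transportL (-η) := by rw [transportL_neg, transportL_neg, h]
    exact funext fun f => LinearMap.congr_fun h' f
  rw [e]

theorem AgreeAt.symm {ξ η : A.Vec} {X₀ : Doubled D} (h : AgreeAt ξ η X₀) : AgreeAt η ξ X₀ :=
  fun f n => (h f n).symm

theorem AgreeAt.trans {ξ η ζ : A.Vec} {X₀ : Doubled D} (h : AgreeAt ξ η X₀)
    (h' : AgreeAt η ζ X₀) : AgreeAt ξ ζ X₀ := fun f n => (h f n).trans (h' f n)

theorem isTrivial_sub_sub_bchDelta (hA : A.IsSection) {ξ ξ' χ : A.Vec} (hξ : ξ ∈ fil 1)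
    (hξ' : ξ' ∈ fil 1) {X₀ : Doubled D} (hX : AgreeAt ξ ξ' X₀) (hχ : χ ∈ fil 1)
    (hχ' : χ ∈ quasiTrivial A) (h : largeG ξ' = largeG ξ ∘ largeG χ) :
    IsTrivial (ξ' - ξ - bchDelta ξ χ) := by
  have hT : transportL ξ = transportL (ξ + bchDelta ξ χ) := by
    rw [map_add, transportL_quasiTrivial (bchDelta_mem_quasiTrivial hξ hχ hχ'), add_zero]
  rw [sub_sub]
  exact isTrivial_sub_of_largeG_eq hA hξ' (Submodule.add_mem _ hξ (bchDelta_mem_fil hξ hχ))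
    (by rw [h, largeG_add_bchDelta hξ hχ hχ'])
    (hX.symm.trans (agreeAt_of_transportL_eq hT X₀))

end FieldAlgebra
end

open FieldAlgebra in
theorem theorem1 (D : ℕ) (A : FieldAlgebra D) :
    -- a quasi-trivial change of the parameter gives a decomposition, with the stated `δ`
    (∀ ξ δ : A.Vec, IsParam ξ → IsParam δ → IsQuasiTrivial δ →
      ∃ χ : A.Vec, IsParam χ ∧ IsQuasiTrivial χ ∧
        largeG (ξ + δ) = largeG ξ ∘ largeG χ ∧ IsTrivial (δ - bchDelta ξ χ)) ∧
    -- for quasi-trivial `χ`, the stated `δ` is quasi-trivial and gives the decomposition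
    (∀ ξ χ : A.Vec, IsParam ξ → IsParam χ → IsQuasiTrivial χ →
      IsParam (bchDelta ξ χ) ∧
      ∀ δ : A.Vec, IsParam δ → IsTrivial (δ - bchDelta ξ χ) →
        IsQuasiTrivial δ ∧ largeG (ξ + δ) = largeG ξ ∘ largeG χ) ∧
    -- if the strong constraint is solved by a maximal isotropic subspace, every decomposition
    -- arises in this way, apart from rigid translations
    (A.IsSection → ∀ ξ ξ' : A.Vec, IsParam ξ → IsParam ξ' →
      (IsQuasiTrivial (ξ' - ξ) ↔
        (∃ X₀, AgreeAt ξ ξ' X₀) ∧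
          ∃ χ : A.Vec, IsParam χ ∧ IsQuasiTrivial χ ∧ largeG ξ' = largeG ξ ∘ largeG χ) ∧
      ((∃ X₀, AgreeAt ξ ξ' X₀) →
        ∀ χ : A.Vec, IsParam χ → IsQuasiTrivial χ → largeG ξ' = largeG ξ ∘ largeG χ →
          IsTrivial (ξ' - ξ - bchDelta ξ χ))) := by
  simp only [isParam_iff, isQuasiTrivial_iff]
  have h1 : ∀ ξ δ : A.Vec, ξ ∈ FilteredModule.fil 1 → δ ∈ FilteredModule.fil 1 →
      δ ∈ quasiTrivial A → ∃ χ ∈ FilteredModule.fil 1, χ ∈ quasiTrivial A ∧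
        largeG (ξ + δ) = largeG ξ ∘ largeG χ ∧ IsTrivial (δ - bchDelta ξ χ) := by
    intro ξ δ hξ hδ hδ'
    obtain ⟨χ, hχ, hχ', rfl⟩ := exists_bchDelta_eq hξ hδ hδ'
    exact ⟨χ, hχ, hχ', largeG_add_bchDelta hξ hχ hχ', 0, fun M => by rw [sub_self, d_zero]; rfl⟩
  refine ⟨h1, fun ξ χ hξ hχ hχ' => ⟨bchDelta_mem_fil hξ hχ, fun δ hδ h =>
    largeG_add_of_isTrivial hξ hχ hχ' hδ h⟩, fun hA ξ ξ' hξ hξ' => ⟨⟨fun h => ?_, ?_⟩, ?_⟩⟩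
  · obtain ⟨χ, hχ, hχ', hG, -⟩ := h1 ξ (ξ' - ξ) hξ (Submodule.sub_mem _ hξ' hξ) h
    rw [add_sub_cancel] at hG
    -- The origin is an arbitrary choice: the two transports coincide, so the parameters agree
    -- everywhere.
    refine ⟨⟨0, agreeAt_of_transportL_eq ?_ 0⟩, χ, hχ, hχ', hG⟩
    exact (transportL_eq_of_sub (transportL_quasiTrivial h)).symm
  · rintro ⟨⟨X₀, hX⟩, χ, hχ, hχ', hG⟩
    have ht := isTrivial_mem_quasiTrivial (isTrivial_sub_sub_bchDelta hA hξ hξ' hX hχ hχ' hG)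
    simpa using Submodule.add_mem _ ht (bchDelta_mem_quasiTrivial hξ hχ hχ')
  · rintro ⟨X₀, hX⟩ χ hχ hχ' hG
    exact isTrivial_sub_sub_bchDelta hA hξ hξ' hX hχ hχ' hG
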